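/- Let $k<n$ and let $(M^{2n},\omega)$ be a smooth ($C^\infty$, Hausdorff) symplectic manifold of dimension $2n$. For a smooth function $F$ let $JdF$ be its Hamiltonian vector field, determined by $\omega(x,JdF)=dF(x)$ for all tangent vectors $x$. Let $F_1,\dots,F_k:M\to\mathbb R$ be smooth functions in involution, $\omega(JdF_i,JdF_j)=0$ on $M$ for all $i,j$, whose Hamiltonian flows $g_j^t$ are defined for all $t\in\mathbb R$, and put $g^{\vec t}=g_1^{t_1}\circ\dots\circ g_k^{t_k}$ for $\vec t\in\mathbb R^k$. Let $\Lambda^k\subset M$ be an embedded smooth torus $S^1\times\dots\times S^1$ of dimension $k$ which is isotropic and invariant (i.e. $JdF_j(p)\in T_p\Lambda^k$ for all $p\in\Lambda^k$ and all $j$), and assume that $dF_1,\dots,dF_k$ are linearly independent at each point of $\Lambda^k$. Write $[\cdot,\cdot]$ for the $\mathbb C$-bilinear extension of $\omega$ to the complexified tangent spaces $(T_pM)^{\mathbb C}$. A complex subspace $N\subset (T_pM)^{\mathbb C}$ is Lagrangian if $\dim_{\mathbb C}N=n$ and $[x,y]=0$ for all $x,y\in N$. For $p\in\Lambda^k$ say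 that $N$ is dissipative with respect to $T_p\Lambda^k$ if $\frac1{2i}[x,\bar x]>0$ for all $x\in N\setminus (T_p\Lambda^k)^{\mathbb C}$. A complex germ on $\Lambda^k$ with respect to the Hamiltonian systems of $F_1,\dots,F_k$ is a family of complex subspaces $r(p)\subset (T_pM)^{\mathbb C}$, $p\in\Lambda^k$, which depends smoothly on $p$ (locally it is spanned by $n$ smooth complex vector fields along $\Lambda^k$) and is such that, for every $p\in\Lambda^k$: $r(p)$ is Lagrangian; $(T_p\Lambda^k)^{\mathbb C}\subset r(p)$; $r(p)$ is dissipative with respect to $T_p\Lambda^k$; and $(g_j^t)_{*,p}\,r(p)=r(g_j^t p)$ for all $j$ and all $t\in\mathbb R$, where $(\cdot)_{*,p}$ denotes the complexified derivative at $p$. Fix $m\in\Lambda^k$, and let $T_1,\dots,T_k\in\mathbb R^k$ be linearly independent generators of the period group $G=\{\vec t\in\mathbb R^k: g^{\vec t}m=m\}$, so that $G=\{l_1T_1+\dots+l_kT_k:\ l_i\in\mathbb Z\}$. Let $G_i=(g^{T_i})_{*,m}$ be the corresponding monodromy operators on $T_mM$, complexified. Suppose that a complex subspace $N\subset (T_mM)^{\mathbb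 C}$ is Lagrangian, dissipative with respect to $T_m\Lambda^k$, and invariant, $G_iN\subset N$, for $i=1,\dots,k$. Then: (a) there exists a complex germ on $\Lambda^k$ with respect to the Hamiltonian systems of $F_1,\dots,F_k$; (b) if moreover $(T_m\Lambda^k)^{\mathbb C}\subset N$, then every point of $\Lambda^k$ is of the form $g^{\vec s}m$ with $\vec s\in\mathbb R^k$, and $$r(g^{\vec s}m)=(g^{\vec s})_{*,m}N,\qquad \vec s\in\mathbb R^k,$$ is a well-defined complex germ on $\Lambda^k$ with respect to the Hamiltonian systems of $F_1,\dots,F_k$. -/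

import Mathlib

open scoped Manifold ContDiff TensorProduct Topology

noncomputable section

namespace Germ

/-! ### Symplectic manifolds -/

/-- A symplectic structure on a smooth manifold `M` of dimension `2n`: a smooth, antisymmetric,
non-degenerate, closed 2-form. -/
structure SymplecticForm (n : ℕ) (M : Type*) [TopologicalSpace M]
    [ChartedSpace (EuclideanSpace ℝ (Fin (2 * n))) M] [IsManifold (𝓡 (2 * n)) ∞ M] where
  /-- the value of the form at a point -/
  toFun : ∀ m : M,
    TangentSpace (𝓡 (2 * n)) m →L[ℝ] TangentSpace (𝓡 (2 * n)) m →L[ℝ] ℝ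
  smooth : ContMDiff (𝓡 (2 * n))
    ((𝓡 (2 * n)).prod 𝓘(ℝ, EuclideanSpace ℝ (Fin (2 * n)) →L[ℝ]
      EuclideanSpace ℝ (Fin (2 * n)) →L[ℝ] ℝ)) ∞
    (fun m ↦ Bundle.TotalSpace.mk' (EuclideanSpace ℝ (Fin (2 * n)) →L[ℝ]
      EuclideanSpace ℝ (Fin (2 * n)) →L[ℝ] ℝ) m (toFun m))
  antisymm : ∀ (m : M) (x y : TangentSpace (𝓡 (2 * n)) m), toFun m x y = - toFun m y x
  nondegenerate : ∀ (m : M) (y : TangentSpace (𝓡 (2 * n)) m), (∀ x, toFun m x y = 0) → y = 0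
  /-- `dΩ = 0`. In the coordinates given by the chart at `c`, the coefficient `Ω(v, w)` on the
  constant fields `v, w` is a function of the coordinate `y`, and
  `dΩ(u, v, w) = ∂_u Ω(v, w) - ∂_v Ω(u, w) + ∂_w Ω(u, v)`. -/
  closed : ∀ (c : M), ∀ y ∈ (extChartAt (𝓡 (2 * n)) c).target,
    ∀ u v w : EuclideanSpace ℝ (Fin (2 * n)),
      let coeff : EuclideanSpace ℝ (Fin (2 * n)) → EuclideanSpace ℝ (Fin (2 * n)) →
          EuclideanSpace ℝ (Fin (2 * n)) → ℝ := fun a b z ↦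
        toFun ((extChartAt (𝓡 (2 * n)) c).symm z)
          (mfderiv 𝓘(ℝ, EuclideanSpace ℝ (Fin (2 * n))) (𝓡 (2 * n))
            (extChartAt (𝓡 (2 * n)) c).symm z a)
          (mfderiv 𝓘(ℝ, EuclideanSpace ℝ (Fin (2 * n))) (𝓡 (2 * n))
            (extChartAt (𝓡 (2 * n)) c).symm z b)
      fderiv ℝ (coeff v w) y u - fderiv ℝ (coeff u w) y v + fderiv ℝ (coeff u v) y w = 0

section

variable {n k : ℕ} {M : Type*} [TopologicalSpace M]
  [ChartedSpace (EuclideanSpace ℝ (Fin (2 * n))) M] [IsManifold (𝓡 (2 * n)) ∞ M]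

instance (m : M) : FiniteDimensional ℝ (TangentSpace (𝓡 (2 * n)) m) :=
  inferInstanceAs (FiniteDimensional ℝ (EuclideanSpace ℝ (Fin (2 * n))))

/-- The differential `dF` of a function at a point, as a covector. -/
def diff (F : M → ℝ) (m : M) : Module.Dual ℝ (TangentSpace (𝓡 (2 * n)) m) :=
  (mfderiv (𝓡 (2 * n)) 𝓘(ℝ, ℝ) F m : TangentSpace (𝓡 (2 * n)) m →L[ℝ] ℝ).toLinearMap

namespace SymplecticForm

variable (Ω : SymplecticForm n M)

/-- The map `y ↦ Ω(·, y)` from the tangent to the cotangent space. -/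
def flat (m : M) : TangentSpace (𝓡 (2 * n)) m →ₗ[ℝ] Module.Dual ℝ (TangentSpace (𝓡 (2 * n)) m) where
  toFun y :=
    { toFun := fun x ↦ Ω.toFun m x y
      map_add' := fun a b ↦ by simp
      map_smul' := fun a b ↦ by simp }
  map_add' a b := by ext x; simp
  map_smul' a b := by ext x; simp

theorem flat_injective (m : M) : Function.Injective (Ω.flat m) := by
  rw [injective_iff_map_eq_zero]
  intro y hy
  exact Ω.nondegenerate m y fun x ↦ LinearMap.congr_fun hy x

/-- The isomorphism `J : T*_m M → T_m M`, characterised by `Ω(x, J a) = a(x)`. -/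
def J (m : M) : Module.Dual ℝ (TangentSpace (𝓡 (2 * n)) m) ≃ₗ[ℝ] TangentSpace (𝓡 (2 * n)) m :=
  (LinearMap.linearEquivOfInjective (Ω.flat m) (Ω.flat_injective m)
    Subspace.dual_finrank_eq.symm).symm

theorem apply_J (m : M) (a : Module.Dual ℝ (TangentSpace (𝓡 (2 * n)) m))
    (x : TangentSpace (𝓡 (2 * n)) m) : Ω.toFun m x (Ω.J m a) = a x := by
  have h : Ω.flat m (Ω.J m a) = a :=
    (LinearMap.linearEquivOfInjective (Ω.flat m) (Ω.flat_injective m)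
      Subspace.dual_finrank_eq.symm).apply_symm_apply a
  exact LinearMap.congr_fun h x

/-- The Hamiltonian vector field `J dF` of a function `F`. -/
def hamField (F : M → ℝ) (m : M) : TangentSpace (𝓡 (2 * n)) m :=
  Ω.J m (diff F m)

/-- The Poisson bracket `[F, G] = Ω(J dF, J dG)`. -/
def poisson (F G : M → ℝ) (m : M) : ℝ :=
  Ω.toFun m (Ω.hamField F m) (Ω.hamField G m)

end SymplecticForm

/-! ### Flows and the `ℝ^k`-action -/

/-- A vector field is complete if through each point there passes an integral curve that is
defined for all times. -/
def IsCompleteField (X : ∀ m : M, TangentSpace (𝓡 (2 * n)) m) : Prop :=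
  ∀ m : M, ∃ γ : ℝ → M, γ 0 = m ∧ IsMIntegralCurve (I := 𝓡 (2 * n)) γ X

open Classical in
/-- The flow of a vector field: `flow X t m` is the value at time `t` of the integral curve with
initial point `m` (and `m` itself if there is no such curve, which does not occur when `X` is
complete). -/
def flow (X : ∀ m : M, TangentSpace (𝓡 (2 * n)) m) (t : ℝ) (m : M) : M :=
  if h : ∃ γ : ℝ → M, γ 0 = m ∧ IsMIntegralCurve (I := 𝓡 (2 * n)) γ X then h.choose t else m

namespace SymplecticForm

variable (Ω : SymplecticForm n M)

/-- The Hamiltonian phase flow `g_F^t`. -/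
def hamFlow (F : M → ℝ) (t : ℝ) : M → M :=
  flow (Ω.hamField F) t

/-- `g^t = g_1^{t_1} ∘ ⋯ ∘ g_k^{t_k}` for `t ∈ ℝ^k`. -/
def action (F : Fin k → M → ℝ) (t : Fin k → ℝ) : M → M :=
  (List.ofFn fun j ↦ Ω.hamFlow (F j) (t j)).foldr (fun f g ↦ f ∘ g) id

/-- `T_1, …, T_k` are linearly independent and generate the period group
`G = {t ∈ ℝ^k : g^t m = m}`. -/
def IsPeriodBasis (F : Fin k → M → ℝ) (m : M) (T : Fin k → Fin k → ℝ) : Prop :=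
  LinearIndependent ℝ T ∧
    {t : Fin k → ℝ | Ω.action F t m = m} = Set.range fun l : Fin k → ℤ ↦ ∑ i, l i • T i

end SymplecticForm

/-- The identification of the tangent spaces at two points that are equal. -/
def tangentCast {p q : M} (h : p = q) :
    TangentSpace (𝓡 (2 * n)) p →L[ℝ] TangentSpace (𝓡 (2 * n)) q :=
  h ▸ ContinuousLinearMap.id ℝ (TangentSpace (𝓡 (2 * n)) p)

/-- The derivative at a fixed point `m` of `g`, as an endomorphism of `T_m M`. -/
def derivAtFixedPoint (g : M → M) (m : M) (h : g m = m) :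
    TangentSpace (𝓡 (2 * n)) m →L[ℝ] TangentSpace (𝓡 (2 * n)) m :=
  (tangentCast h).comp (mfderiv (𝓡 (2 * n)) (𝓡 (2 * n)) g m)

/-! ### Complexified tangent spaces -/

/-- The complexification of a real vector space: `1 ⊗ x + i ⊗ y` stands for `x + i y`. -/
abbrev Cx (V : Type*) [AddCommGroup V] [Module ℝ V] : Type _ := ℂ ⊗[ℝ] V

/-- Complex conjugation `x + i y ↦ x - i y`. -/
def conj (V : Type*) [AddCommGroup V] [Module ℝ V] : Cx V →ₗ[ℝ] Cx V :=
  LinearMap.rTensor V Complex.conjAe.toLinearMap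

/-- The image of a complex subspace under the complexification of a real linear map. -/
def push {V W : Type*} [AddCommGroup V] [Module ℝ V] [AddCommGroup W] [Module ℝ W]
    (f : V →ₗ[ℝ] W) (N : Submodule ℂ (Cx V)) : Submodule ℂ (Cx W) :=
  N.map (f.baseChange ℂ)

namespace SymplecticForm

variable (Ω : SymplecticForm n M)

/-- The symplectic form at a point as a bilinear form. -/
def bilin (m : M) : LinearMap.BilinForm ℝ (TangentSpace (𝓡 (2 * n)) m) :=
  LinearMap.mk₂ ℝ (fun x y ↦ Ω.toFun m x y) (by simp) (by simp) (by simp) (by simp)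

/-- The `ℂ`-bilinear extension `[x, y]` of `Ω` to `(T_m M)^ℂ`. -/
def bracket (m : M) : LinearMap.BilinForm ℂ (Cx (TangentSpace (𝓡 (2 * n)) m)) :=
  LinearMap.BilinForm.baseChange ℂ (Ω.bilin m)

/-- A Lagrangian subspace of `(T_m M)^ℂ`: isotropic of complex dimension `n`. -/
def IsLagrangian {m : M} (N : Submodule ℂ (Cx (TangentSpace (𝓡 (2 * n)) m))) : Prop :=
  Module.finrank ℂ N = n ∧ ∀ x ∈ N, ∀ y ∈ N, Ω.bracket m x y = 0

/-- `(1/2i)[x, x̄] > 0` for all `x ∈ N` outside `L` (the number `(1/2i)[x, x̄]` is always real). -/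
def IsDissipative {m : M} (L N : Submodule ℂ (Cx (TangentSpace (𝓡 (2 * n)) m))) : Prop :=
  ∀ x ∈ N, x ∉ L →
    0 < (1 / (2 * Complex.I) * Ω.bracket m x (conj (TangentSpace (𝓡 (2 * n)) m) x)).re

end SymplecticForm

/-! ### Tori -/

/-- A `k`-dimensional torus `S¹ × ⋯ × S¹` embedded as a smooth submanifold of `M`. Smoothness and
the immersion property are expressed in the angle coordinates `(θ_1, …, θ_k)`, which are local
coordinates on the torus; as the torus is compact, an injective immersion is an embedding when
`M` is Hausdorff. -/
structure Torus (n k : ℕ) (M : Type*) [TopologicalSpace M]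
    [ChartedSpace (EuclideanSpace ℝ (Fin (2 * n))) M] where
  /-- the embedding -/
  emb : (Fin k → Circle) → M
  injective : Function.Injective emb
  smooth : ContMDiff 𝓘(ℝ, Fin k → ℝ) (𝓡 (2 * n)) ∞
    (fun θ : Fin k → ℝ ↦ emb fun j ↦ Circle.exp (θ j))
  immersion : ∀ θ : Fin k → ℝ, Function.Injective
    (mfderiv 𝓘(ℝ, Fin k → ℝ) (𝓡 (2 * n)) (fun θ : Fin k → ℝ ↦ emb fun j ↦ Circle.exp (θ j)) θ)

namespace Torus

variable (Λ : Torus n k M)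

/-- The point of the torus with angles `θ`. -/
def pt (θ : Fin k → ℝ) : M := Λ.emb fun j ↦ Circle.exp (θ j)

/-- The tangent space to the torus at the point with angles `θ`. -/
def tangent (θ : Fin k → ℝ) : Submodule ℝ (TangentSpace (𝓡 (2 * n)) (Λ.pt θ)) :=
  LinearMap.range (mfderiv 𝓘(ℝ, Fin k → ℝ) (𝓡 (2 * n)) Λ.pt θ).toLinearMap

/-- The complexified tangent space to the torus at the point with angles `θ`. -/
def tangentC (θ : Fin k → ℝ) : Submodule ℂ (Cx (TangentSpace (𝓡 (2 * n)) (Λ.pt θ))) :=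
  (Λ.tangent θ).baseChange ℂ

/-- The torus is isotropic: `Ω` vanishes on its tangent spaces. -/
def IsIsotropic (Ω : SymplecticForm n M) : Prop :=
  ∀ θ, ∀ x ∈ Λ.tangent θ, ∀ y ∈ Λ.tangent θ, Ω.toFun (Λ.pt θ) x y = 0

/-- The torus is invariant with respect to the Hamiltonian system of `H`: the field `J dH` is
tangent to it. -/
def IsInvariant (Ω : SymplecticForm n M) (H : M → ℝ) : Prop :=
  ∀ θ, Ω.hamField H (Λ.pt θ) ∈ Λ.tangent θ

/-- A family of `n`-dimensional complex subspaces over the torus is smooth if locally it is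
spanned by `n` smooth (complex) vector fields `a_i + i b_i` along the torus. Only the values of
`r` at points of the torus matter. -/
def IsSmoothFamily (r : ∀ p : M, Submodule ℂ (Cx (TangentSpace (𝓡 (2 * n)) p))) : Prop :=
  ∀ θ₀ : Fin k → ℝ, ∃ U ∈ 𝓝 θ₀,
    ∃ a b : Fin n → ∀ θ : Fin k → ℝ, TangentSpace (𝓡 (2 * n)) (Λ.pt θ),
      (∀ i, ContMDiffOn 𝓘(ℝ, Fin k → ℝ) (𝓡 (2 * n)).tangent ∞
        (fun θ ↦ (⟨Λ.pt θ, a i θ⟩ : TangentBundle (𝓡 (2 * n)) M)) U) ∧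
      (∀ i, ContMDiffOn 𝓘(ℝ, Fin k → ℝ) (𝓡 (2 * n)).tangent ∞
        (fun θ ↦ (⟨Λ.pt θ, b i θ⟩ : TangentBundle (𝓡 (2 * n)) M)) U) ∧
      ∀ θ ∈ U, r (Λ.pt θ) = Submodule.span ℂ
        (Set.range fun i ↦ (1 : ℂ) ⊗ₜ[ℝ] a i θ + Complex.I ⊗ₜ[ℝ] b i θ)

/-- A complex germ over the torus with respect to the Hamiltonian systems of `F_1, …, F_k`. The
map `r` is considered on the torus only; its values elsewhere are irrelevant. -/
structure IsComplexGerm (Ω : SymplecticForm n M) (F : Fin k → M → ℝ)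
    (r : ∀ p : M, Submodule ℂ (Cx (TangentSpace (𝓡 (2 * n)) p))) : Prop where
  smooth : Λ.IsSmoothFamily r
  lagrangian : ∀ θ, Ω.IsLagrangian (r (Λ.pt θ))
  tangent_le : ∀ θ, Λ.tangentC θ ≤ r (Λ.pt θ)
  dissipative : ∀ θ, Ω.IsDissipative (Λ.tangentC θ) (r (Λ.pt θ))
  invariant : ∀ (j : Fin k) (θ : Fin k → ℝ) (t : ℝ),
    push (mfderiv (𝓡 (2 * n)) (𝓡 (2 * n)) (Ω.hamFlow (F j) t) (Λ.pt θ)).toLinearMap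
      (r (Λ.pt θ)) = r (Ω.hamFlow (F j) t (Λ.pt θ))

end Torus

end

end Germ

end

/-! Transport `N` along the orbit of `m`. Hamiltonian flows preserve the symplectic form
(`form_hamFlow`), and flows of functions in involution commute and preserve each other's Hamiltonian
fields (`hamFlow_comm`, `der_hamFlow_ham`). Hence `g` is an action of ℝ^k by symplectic maps that
carries every field J dF_j to itself (`action_add`, `form_action`, `der_action_ham`).

These fields are tangent to the torus and independent, so for dimension reasons they span its
tangent spaces (`range_hamFrame`). Writing the angle directions in terms of them and integrating
along segments of angles gives a smooth s(θ) with g^{s(θ)} m equal to the point with angles θ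
(`exists_smooth_action_eq`). So the torus is one orbit. The image of `N` under g^s depends only on
g^s m: two choices of s differ by a period, and `N` is fixed by all monodromy operators once it is
invariant under those of the generators (`push_eq_of_isPeriodBasis`, `orbitFamily_action`). Being
Lagrangian, dissipative and containing the tangent space are preserved by the action, and smoothness
of the family comes from that of s(θ) (`isComplexGerm_orbitFamily`). This proves (b).

For (a), let L be the complexified tangent space at m and replace `N` by (N ∩ L^⊥) + L. This is
again Lagrangian and dissipative, and it contains L (`finrank_adjoin`, `adjoin_isotropic`,
`adjoin_dissipative`). It is again invariant because the monodromy operators fix L pointwise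
(`push_adjoin_le`).

The analytic input is smoothness of the flow jointly in time and space (`contMDiff_flow`), obtained
from the inverse function theorem in a space of continuous curves. -/

open scoped Manifold ContDiff TensorProduct Topology

noncomputable section

namespace Germ

/-! ### Smoothness of superposition operators on spaces of continuous functions. -/

section Nemytskii

universe u

variable {K : Type*} [TopologicalSpace K] [CompactSpace K]

/-- The operator between spaces of continuous functions that is given pointwise by a continuous
family of operators. -/
def pointwiseOperator {E F : Type*} [NormedAddCommGroup E] [NormedSpace ℝ E]
    [NormedAddCommGroup F] [NormedSpace ℝ F] (A : C(K, E →L[ℝ] F)) : C(K, E) →L[ℝ] C(K, F) :=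
  LinearMap.mkContinuous
    { toFun := fun h ↦ ⟨fun x ↦ A x (h x), by fun_prop⟩
      map_add' := fun _ _ ↦ by ext; simp
      map_smul' := fun _ _ ↦ by ext; simp } ‖A‖ fun h ↦ by
    rw [ContinuousMap.norm_le _ (by positivity)]
    exact fun x ↦ (A x).le_of_opNorm_le_of_le (A.norm_coe_le_norm x) (h.norm_coe_le_norm x)

theorem norm_pointwiseOperator_le {E F : Type*} [NormedAddCommGroup E] [NormedSpace ℝ E]
    [NormedAddCommGroup F] [NormedSpace ℝ F] (A : C(K, E →L[ℝ] F)) :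
    ‖pointwiseOperator A‖ ≤ ‖A‖ := by
  have h0 : 0 ≤ ‖A‖ := by positivity
  exact LinearMap.mkContinuous_norm_le _ h0 _

/-- Evaluation of a continuous family of operators on a continuous family of vectors. -/
def pointwiseApply (K : Type*) [TopologicalSpace K] [CompactSpace K]
    (E F : Type*) [NormedAddCommGroup E] [NormedSpace ℝ E] [NormedAddCommGroup F]
    [NormedSpace ℝ F] : C(K, E →L[ℝ] F) →L[ℝ] C(K, E) →L[ℝ] C(K, F) :=
  let B : C(K, E →L[ℝ] F) →ₗ[ℝ] C(K, E) →L[ℝ] C(K, F) :=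
    { toFun := pointwiseOperator
      map_add' := fun _ _ ↦ rfl
      map_smul' := fun _ _ ↦ rfl }
  B.mkContinuous 1 fun A : C(K, E →L[ℝ] F) ↦
    (norm_pointwiseOperator_le A).trans_eq (one_mul _).symm

/-- Postcomposition with `f'` is continuous, so `f' ∘ u` is uniformly close to `f' ∘ v` for u in a
ball about v. The ball is convex, so this covers the segments from `v x` to `w x`, and the mean
value inequality at each x gives an estimate uniform in x. -/
theorem hasFDerivAt_comp_continuousMap {E F : Type*} [NormedAddCommGroup E] [NormedSpace ℝ E]
    [NormedAddCommGroup F] [NormedSpace ℝ F] (f : C(E, F)) (f' : C(E, E →L[ℝ] F))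
    (hf : ∀ x, HasFDerivAt f (f' x) x) (v : C(K, E)) :
    HasFDerivAt (fun u : C(K, E) ↦ f.comp u) (pointwiseApply K E F (f'.comp v)) v := by
  rw [hasFDerivAt_iff_isLittleO, Asymptotics.isLittleO_iff]
  intro c hc
  have hcont : ContinuousAt (fun u : C(K, E) ↦ f'.comp u) v :=
    (ContinuousMap.continuous_postcomp f').continuousAt
  obtain ⟨δ, hδ, hball⟩ := (Metric.continuousAt_iff (f := fun u : C(K, E) ↦ f'.comp u)).1 hcont c hc
  filter_upwards [Metric.ball_mem_nhds v hδ] with w hw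
  rw [ContinuousMap.norm_le _ (by positivity)]
  intro x
  have hseg : ∀ y ∈ segment ℝ (v x) (w x), ‖f' y - f' (v x)‖ ≤ c := by
    rintro y ⟨a, b, ha, hb, hab, rfl⟩
    have hmem : a • v + b • w ∈ Metric.ball v δ :=
      (convex_ball v δ) (Metric.mem_ball_self hδ) hw ha hb hab
    have h1 := hball hmem
    have h2 := (ContinuousMap.dist_apply_le_dist x).trans h1.le
    exact (dist_eq_norm (f' (a • v x + b • w x)) (f' (v x))).symm.trans_le h2
  have := (convex_segment (𝕜 := ℝ) (v x) (w x)).norm_image_sub_le_of_norm_hasFDerivWithin_le'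
    (fun y _ ↦ (hf y).hasFDerivWithinAt) hseg (left_mem_segment ℝ _ _) (right_mem_segment ℝ _ _)
  change ‖f (w x) - f (v x) - (f' (v x)) (w x - v x)‖ ≤ c * ‖w - v‖
  exact this.trans (mul_le_mul_of_nonneg_left ((w - v).norm_coe_le_norm x) hc.le)

/-- The derivative is again a superposition operator, that of `f'`, followed by the continuous
linear map `pointwiseApply`. The induction therefore has to let the codomain vary, and one universe
holds both `F` and `E →L[ℝ] F`. -/
theorem contDiff_nat_comp_continuousMap {E : Type u} [NormedAddCommGroup E] [NormedSpace ℝ E]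
    (m : ℕ) : ∀ {F : Type u} [NormedAddCommGroup F] [NormedSpace ℝ F] (f : C(E, F)),
      ContDiff ℝ m f → ContDiff ℝ m (fun u : C(K, E) ↦ f.comp u) := by
  induction m with
  | zero =>
    intro F _ _ f _
    exact contDiff_zero.2 (ContinuousMap.continuous_postcomp f)
  | succ m ih =>
    intro F _ _ f hf
    push_cast at hf ⊢
    obtain ⟨hd, -, hf'⟩ := contDiff_succ_iff_fderiv.1 hf
    let f' : C(E, E →L[ℝ] F) := ⟨fderiv ℝ f, hf'.continuous⟩
    have hD := hasFDerivAt_comp_continuousMap (K := K) f f' fun x ↦ (hd x).hasFDerivAt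
    refine contDiff_succ_iff_fderiv.2 ⟨fun v ↦ (hD v).differentiableAt, by simp, ?_⟩
    rw [show fderiv ℝ (fun u : C(K, E) ↦ f.comp u)
      = fun v ↦ pointwiseApply K E F (f'.comp v) from funext fun v ↦ (hD v).fderiv]
    exact (pointwiseApply K E F).contDiff.comp (ih f' hf')

/-- Composition on the left with a smooth map is smooth on spaces of continuous functions. -/
theorem contDiff_comp_continuousMap {E F : Type u} [NormedAddCommGroup E] [NormedSpace ℝ E]
    [NormedAddCommGroup F] [NormedSpace ℝ F] (f : C(E, F)) (hf : ContDiff ℝ ∞ f) :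
    ContDiff ℝ ∞ (fun u : C(K, E) ↦ f.comp u) :=
  contDiff_infty.2 fun m ↦ contDiff_nat_comp_continuousMap m f (contDiff_infty.1 hf m)

end Nemytskii

/-! ### Integration as a continuous operator on curves. -/

section Primitive

variable {E : Type*} [NormedAddCommGroup E]

/-- The interval `[-1, 2]`, a neighbourhood of `0` and of `1`. -/
abbrev TimeInterval : Type := Set.Icc (-1 : ℝ) 2

/-- The extension of a function on `[-1, 2]` to the line, constant outside the interval. -/
def extendTime (u : C(TimeInterval, E)) (t : ℝ) : E :=
  u (Set.projIcc (-1) 2 (by norm_num) t)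

theorem continuous_extendTime (u : C(TimeInterval, E)) : Continuous (extendTime u) :=
  u.continuous.comp continuous_projIcc

theorem norm_extendTime_le (u : C(TimeInterval, E)) (t : ℝ) : ‖extendTime u t‖ ≤ ‖u‖ :=
  u.norm_coe_le_norm _

theorem extendTime_coe (u : C(TimeInterval, E)) (t : TimeInterval) : extendTime u t = u t := by
  simp [extendTime]

variable [NormedSpace ℝ E] [CompleteSpace E]

/-- The primitive vanishing at `0`. -/
def primitive (E : Type*) [NormedAddCommGroup E] [NormedSpace ℝ E] [CompleteSpace E] :
    C(TimeInterval, E) →L[ℝ] C(TimeInterval, E) :=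
  LinearMap.mkContinuous
    { toFun := fun u ↦ ⟨fun t ↦ ∫ s in (0 : ℝ)..t, extendTime u s,
        (intervalIntegral.continuous_primitive
          (fun _ _ ↦ (continuous_extendTime u).intervalIntegrable _ _) 0).comp
            continuous_subtype_val⟩
      map_add' := fun u v ↦ by
        ext t
        exact intervalIntegral.integral_add ((continuous_extendTime u).intervalIntegrable _ _)
          ((continuous_extendTime v).intervalIntegrable _ _)
      map_smul' := fun c u ↦ by
        ext t
        exact intervalIntegral.integral_smul c _ } 2
    fun u ↦ by
      rw [ContinuousMap.norm_le _ (by positivity)]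
      intro t
      refine (intervalIntegral.norm_integral_le_of_norm_le_const
        fun s _ ↦ norm_extendTime_le u s).trans ?_
      rw [mul_comm]
      refine mul_le_mul_of_nonneg_right ?_ (norm_nonneg u)
      rw [sub_zero, abs_le]
      exact ⟨by linarith [t.2.1], t.2.2⟩

theorem primitive_apply (u : C(TimeInterval, E)) (t : TimeInterval) :
    primitive E u t = ∫ s in (0 : ℝ)..t, extendTime u s := rfl

theorem hasDerivAt_extendTime_primitive (u : C(TimeInterval, E)) {t : ℝ}
    (ht : t ∈ Set.Ioo (-1 : ℝ) 2) :
    HasDerivAt (extendTime (primitive E u)) (extendTime u t) t := by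
  have h := intervalIntegral.integral_hasDerivAt_right
    ((continuous_extendTime u).intervalIntegrable 0 t)
    (continuous_extendTime u).stronglyMeasurable.stronglyMeasurableAtFilter
    (continuous_extendTime u).continuousAt
  refine h.congr_of_eventuallyEq ?_
  filter_upwards [Ioo_mem_nhds ht.1 ht.2] with s hs
  exact extendTime_coe (primitive E u) ⟨s, Set.Ioo_subset_Icc_self hs⟩

end Primitive

/-! ### Smooth dependence of solutions on parameters in a Banach space. -/

section LocalFlow

universe u

variable {E : Type u} [NormedAddCommGroup E] [NormedSpace ℝ E] [CompleteSpace E]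

/-- Solutions of `u' = ε f(u)`, `u(0) = x` on a fixed time interval exist for `(ε, x)` close to
`(0, x₀)` and depend smoothly on `(ε, x)`. -/
theorem exists_smooth_solution (f : E → E) (hf : ContDiff ℝ ∞ f) (x₀ : E) :
    ∃ u : ℝ × E → C(TimeInterval, E), ContDiffAt ℝ ∞ u (0, x₀) ∧
      u (0, x₀) = ContinuousMap.const _ x₀ ∧
      ∀ᶠ q in 𝓝 ((0 : ℝ), x₀), extendTime (u q) 0 = q.2 ∧ ∀ t ∈ Set.Ioo (-1 : ℝ) 2,
        HasDerivAt (extendTime (u q)) (q.1 • f (extendTime (u q) t)) t := by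
  let fc : C(E, E) := ⟨f, hf.continuous⟩
  let c₀ : C(TimeInterval, E) := ContinuousMap.const _ x₀
  let S : C(TimeInterval, E) → C(TimeInterval, E) := fun u ↦ primitive E (fc.comp u)
  have hS : ContDiff ℝ ∞ S := (primitive E).contDiff.comp (contDiff_comp_continuousMap fc hf)
  -- The integral equation u = x + ε S(u) reads Ψ(ε, u) = (ε, x), so a local inverse of Ψ solves it.
  -- At ε = 0 the term in the derivative of S drops out and the derivative of Ψ is a shear, whatever
  -- `f` is.
  let Ψ : ℝ × C(TimeInterval, E) → ℝ × C(TimeInterval, E) := fun q ↦ (q.1, q.2 - q.1 • S q.2)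
  have hΨ : ContDiff ℝ ∞ Ψ :=
    contDiff_fst.prodMk (contDiff_snd.sub (contDiff_fst.smul (hS.comp contDiff_snd)))
  let A : (ℝ × C(TimeInterval, E)) ≃L[ℝ] (ℝ × C(TimeInterval, E)) :=
    ContinuousLinearEquiv.equivOfInverse
      ((ContinuousLinearMap.fst ℝ ℝ _).prod (ContinuousLinearMap.snd ℝ ℝ _ -
        (ContinuousLinearMap.fst ℝ ℝ _).smulRight (S c₀)))
      ((ContinuousLinearMap.fst ℝ ℝ _).prod (ContinuousLinearMap.snd ℝ ℝ _ +
        (ContinuousLinearMap.fst ℝ ℝ _).smulRight (S c₀)))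
      (fun q ↦ by ext <;> simp) (fun q ↦ by ext <;> simp)
  have hA : HasFDerivAt Ψ (A : _ →L[ℝ] _) (0, c₀) := by
    have h2 : HasFDerivAt (fun q : ℝ × C(TimeInterval, E) ↦ S q.2)
        ((fderiv ℝ S c₀).comp (ContinuousLinearMap.snd ℝ ℝ _)) (0, c₀) :=
      ((hS.differentiable (by simp)).differentiableAt (x := c₀)).hasFDerivAt.comp
        ((0 : ℝ), c₀) (f := Prod.snd) hasFDerivAt_snd
    have h3 := hasFDerivAt_fst.prodMk (hasFDerivAt_snd.sub (hasFDerivAt_fst.smul h2))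
    refine h3.congr_fderiv ?_
    ext q <;> simp [A]
  have hΨ0 : Ψ (0, c₀) = (0, c₀) := by simp [Ψ]
  have hΨat : ContDiffAt ℝ ∞ Ψ (0, c₀) := hΨ.contDiffAt
  let G := hΨat.localInverse hA (by simp)
  have hG : ContDiffAt ℝ ∞ G (0, c₀) := by
    have := hΨat.to_localInverse hA (by simp)
    rwa [hΨ0] at this
  have hG0 : G (0, c₀) = (0, c₀) := by
    have := hΨat.localInverse_apply_image hA (by simp)
    rwa [hΨ0] at this
  have hinv : ∀ᶠ y in 𝓝 ((0 : ℝ), c₀), Ψ (G y) = y := by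
    have := (hΨat.hasStrictFDerivAt' hA (by simp)).eventually_right_inverse
    rwa [hΨ0] at this
  let cst : ℝ × E → ℝ × C(TimeInterval, E) := fun q ↦ (q.1, ContinuousMap.const _ q.2)
  have hcst : ContDiff ℝ ∞ cst := by
    let C : E →L[ℝ] C(TimeInterval, E) := LinearMap.mkContinuous
      { toFun := fun x ↦ ContinuousMap.const _ x
        map_add' := fun _ _ ↦ rfl
        map_smul' := fun _ _ ↦ rfl } 1 fun x ↦ by
          rw [ContinuousMap.norm_le _ (by positivity), one_mul]
          exact fun _ ↦ le_rfl
    exact contDiff_fst.prodMk (C.contDiff.comp contDiff_snd)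
  refine ⟨fun q ↦ (G (cst q)).2, ?_, ?_, ?_⟩
  · exact contDiff_snd.contDiffAt.comp (0, x₀) (ContDiffAt.comp (0, x₀) hG hcst.contDiffAt)
  · change (G (0, c₀)).2 = c₀
    rw [hG0]
  · filter_upwards [hcst.continuous.continuousAt (x := (0, x₀)) |>.eventually hinv] with q hq
    obtain ⟨h1, h2⟩ := Prod.ext_iff.1 hq
    change (G (cst q)).1 = q.1 at h1
    change (G (cst q)).2 - (G (cst q)).1 • S (G (cst q)).2 = ContinuousMap.const _ q.2 at h2
    rw [h1] at h2
    set w := (G (cst q)).2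
    have hw : w = ContinuousMap.const _ q.2 + q.1 • S w := by rw [← h2]; abel
    have hpt : ∀ t, extendTime w t = q.2 + q.1 • extendTime (S w) t := fun t ↦
      congrArg (fun v : C(TimeInterval, E) ↦ extendTime v t) hw
    refine ⟨?_, fun t ht ↦ ?_⟩
    · rw [hpt]
      have := extendTime_coe (S w) (⟨0, by norm_num, by norm_num⟩ : TimeInterval)
      rw [primitive_apply, intervalIntegral.integral_same] at this
      rw [this, smul_zero, add_zero]
    · have h := ((hasDerivAt_extendTime_primitive (fc.comp w) ht).const_smul q.1).const_add q.2
      exact h.congr_of_eventuallyEq (.of_forall hpt)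

end LocalFlow

/-- The model space of a manifold of dimension `2n`. -/
abbrev Model (n : ℕ) : Type := EuclideanSpace ℝ (Fin (2 * n))

/-! ### Charts and smooth vector fields in coordinates. -/

section

variable {n : ℕ} {M : Type*} [TopologicalSpace M]
  [ChartedSpace (EuclideanSpace ℝ (Fin (2 * n))) M]

/-- The extended chart at a point. -/
abbrev coord (c : M) : PartialEquiv M (Model n) := extChartAt (𝓡 (2 * n)) c

theorem isOpen_coord_target (c : M) : IsOpen (coord (n := n) c).target :=
  isOpen_extChartAt_target c

variable [IsManifold (𝓡 (2 * n)) ∞ M]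

instance : IsManifold (𝓡 (2 * n)) 1 M := IsManifold.of_le (n := ∞) (by simp)

theorem contMDiffOn_coord_symm (c : M) :
    ContMDiffOn 𝓘(ℝ, Model n) (𝓡 (2 * n)) ∞ (coord (n := n) c).symm (coord (n := n) c).target :=
  contMDiffOn_extChartAt_symm c

theorem mdifferentiableAt_coord_symm (c : M) {z : Model n} (hz : z ∈ (coord (n := n) c).target) :
    MDifferentiableAt 𝓘(ℝ, Model n) (𝓡 (2 * n)) (coord (n := n) c).symm z :=
  ((contMDiffOn_coord_symm c).contMDiffAt ((isOpen_coord_target c).mem_nhds hz)).mdifferentiableAt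
    (by simp)

theorem contMDiffAt_coord (c : M) {p : M} (hp : p ∈ (coord (n := n) c).source) :
    ContMDiffAt (𝓡 (2 * n)) 𝓘(ℝ, Model n) ∞ (coord (n := n) c) p :=
  contMDiffAt_extChartAt' (by rwa [extChartAt_source] at hp)

/-- The derivative of the inverse chart. -/
def frame (c : M) (z : Model n) : Model n →L[ℝ] TangentSpace (𝓡 (2 * n)) ((coord (n := n) c).symm z) :=
  mfderiv 𝓘(ℝ, Model n) (𝓡 (2 * n)) (coord (n := n) c).symm z

/-- The derivative of the chart, at the point with coordinates `z`. -/
def coframe (c : M) (z : Model n) : TangentSpace (𝓡 (2 * n)) ((coord (n := n) c).symm z) →L[ℝ] Model n :=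
  mfderiv (𝓡 (2 * n)) 𝓘(ℝ, Model n) (coord (n := n) c) ((coord (n := n) c).symm z)

theorem coframe_frame (c : M) {z : Model n} (hz : z ∈ (coord (n := n) c).target) (v : Model n) :
    coframe c z (frame c z v) = v := by
  have h1 := (contMDiffAt_coord c ((coord (n := n) c).map_target hz)).mdifferentiableAt (by simp)
  have h2 := mdifferentiableAt_coord_symm c hz
  have h3 : mfderiv 𝓘(ℝ, Model n) 𝓘(ℝ, Model n) ((coord (n := n) c) ∘ (coord (n := n) c).symm) z
      = (coframe c z).comp (frame c z) := mfderiv_comp z h1 h2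
  have h4 : (coord (n := n) c) ∘ (coord (n := n) c).symm =ᶠ[𝓝 z] id := by
    filter_upwards [(isOpen_coord_target c).mem_nhds hz] with y hy
    exact (coord (n := n) c).right_inv hy
  rw [h4.mfderiv_eq, mfderiv_id] at h3
  exact (DFunLike.congr_fun h3 v).symm

/-- In equal finite dimensions a left inverse is also a right inverse. -/
theorem frame_coframe (c : M) {z : Model n} (hz : z ∈ (coord (n := n) c).target)
    (v : TangentSpace (𝓡 (2 * n)) ((coord (n := n) c).symm z)) : frame c z (coframe c z v) = v := by
  have hinj : Function.Injective (frame c z) := Function.LeftInverse.injective (coframe_frame c hz)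
  have hsurj : Function.Surjective (frame c z).toLinearMap :=
    (LinearMap.injective_iff_surjective_of_finrank_eq_finrank rfl).1 hinj
  obtain ⟨w, rfl⟩ := hsurj v
  exact congrArg _ (coframe_frame c hz w)

theorem contMDiffOn_frame (c : M) {f : Model n → Model n}
    (hf : ContDiffOn ℝ ∞ f (coord (n := n) c).target) :
    ContMDiffOn 𝓘(ℝ, Model n) (𝓡 (2 * n)).tangent ∞
      (fun z ↦ (⟨(coord (n := n) c).symm z, frame c z (f z)⟩ : TangentBundle (𝓡 (2 * n)) M))
      (coord (n := n) c).target := by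
  have h1 := (contMDiffOn_coord_symm (n := n) c).contMDiffOn_tangentMapWithin (m := ∞) (by simp)
    (isOpen_coord_target c).uniqueMDiffOn
  have h2 : ContMDiffOn 𝓘(ℝ, Model n) 𝓘(ℝ, Model n).tangent ∞
      (fun z ↦ (⟨z, f z⟩ : TangentBundle 𝓘(ℝ, Model n) (Model n))) (coord (n := n) c).target :=
    contMDiffOn_vectorSpace_iff_contDiffOn.2 hf
  refine (h1.comp h2 fun z hz ↦ hz).congr fun z hz ↦ ?_
  simp only [Function.comp, tangentMapWithin, frame]
  rw [mfderivWithin_of_mem_nhds ((isOpen_coord_target c).mem_nhds hz)]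
  rfl

/-- In every chart the components of the vector field are smooth. -/
def IsSmoothField (X : ∀ m : M, TangentSpace (𝓡 (2 * n)) m) : Prop :=
  ∀ c : M, ContDiffOn ℝ ∞ (fun z ↦ coframe c z (X ((coord (n := n) c).symm z)))
    (coord (n := n) c).target

theorem IsSmoothField.of_frame {X : ∀ m : M, TangentSpace (𝓡 (2 * n)) m}
    (h : ∀ c : M, ∃ f : Model n → Model n, ContDiffOn ℝ ∞ f (coord (n := n) c).target ∧
      ∀ z ∈ (coord (n := n) c).target, X ((coord (n := n) c).symm z) = frame c z (f z)) :
    IsSmoothField X := by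
  intro c
  obtain ⟨f, hf, hX⟩ := h c
  exact hf.congr fun z hz ↦ by simp only [hX z hz, coframe_frame c hz]

omit [IsManifold (𝓡 (2 * n)) ∞ M] in
theorem IsSmoothField.smul {X : ∀ m : M, TangentSpace (𝓡 (2 * n)) m} (hX : IsSmoothField X)
    (a : ℝ) : IsSmoothField (a • X) := fun c ↦ by
  refine ((hX c).const_smul a).congr fun z _ ↦ ?_
  exact (coframe c z).map_smul a _

omit [IsManifold (𝓡 (2 * n)) ∞ M] in
theorem isSmoothField_zero : IsSmoothField (0 : ∀ m : M, TangentSpace (𝓡 (2 * n)) m) :=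
  fun c ↦ (contDiffOn_const (c := (0 : Model n))).congr fun z _ ↦ (coframe c z).map_zero

theorem IsSmoothField.contMDiff {X : ∀ m : M, TangentSpace (𝓡 (2 * n)) m} (hX : IsSmoothField X) :
    ContMDiff (𝓡 (2 * n)) (𝓡 (2 * n)).tangent ∞
      (fun m ↦ (⟨m, X m⟩ : TangentBundle (𝓡 (2 * n)) M)) := by
  intro c
  have hc : coord (n := n) c c ∈ (coord (n := n) c).target := mem_extChartAt_target c
  have h := ((contMDiffOn_frame c (hX c)).contMDiffAt ((isOpen_coord_target c).mem_nhds hc)).comp c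
    (contMDiffAt_coord c (mem_extChartAt_source c))
  refine h.congr_of_eventuallyEq ?_
  filter_upwards [extChartAt_source_mem_nhds (I := 𝓡 (2 * n)) c] with p hp
  have h1 := (coord (n := n) c).left_inv hp
  have h2 := frame_coframe c ((coord (n := n) c).map_source hp)
    (X ((coord (n := n) c).symm (coord (n := n) c p)))
  simp only [Function.comp]
  rw [h2, h1]

end

/-! ### Joint smoothness of the flow of a complete field. -/

section Flow

variable {n : ℕ} {M : Type*} [TopologicalSpace M] [T2Space M]
  [ChartedSpace (EuclideanSpace ℝ (Fin (2 * n))) M] [IsManifold (𝓡 (2 * n)) ∞ M]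
  {X : ∀ m : M, TangentSpace (𝓡 (2 * n)) m}

omit [T2Space M] [IsManifold (𝓡 (2 * n)) ∞ M] in
theorem flow_zero_time (hc : IsCompleteField X) (p : M) : flow X 0 p = p := by
  rw [flow, dif_pos (hc p)]
  exact (hc p).choose_spec.1

omit [T2Space M] [IsManifold (𝓡 (2 * n)) ∞ M] in
theorem isMIntegralCurve_flow (hc : IsCompleteField X) (p : M) :
    IsMIntegralCurve (I := 𝓡 (2 * n)) (fun t ↦ flow X t p) X := by
  have h : (fun t ↦ flow X t p) = (hc p).choose := by
    funext t
    rw [flow, dif_pos (hc p)]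
  rw [h]
  exact (hc p).choose_spec.2

theorem IsSmoothField.eq_of_isMIntegralCurve (hX : IsSmoothField X) {γ γ' : ℝ → M}
    (h : IsMIntegralCurve (I := 𝓡 (2 * n)) γ X) (h' : IsMIntegralCurve (I := 𝓡 (2 * n)) γ' X)
    (h0 : γ 0 = γ' 0) : γ = γ' :=
  isMIntegralCurve_Ioo_eq_of_contMDiff_boundaryless (t₀ := 0) (hX.contMDiff.of_le (by simp)) h h' h0

theorem flow_eq_of_isMIntegralCurve (hX : IsSmoothField X) (hc : IsCompleteField X) {γ : ℝ → M}
    (h : IsMIntegralCurve (I := 𝓡 (2 * n)) γ X) (t : ℝ) : flow X t (γ 0) = γ t :=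
  congrFun (hX.eq_of_isMIntegralCurve (isMIntegralCurve_flow hc (γ 0)) h
    (flow_zero_time hc (γ 0))) t

theorem flow_add (hX : IsSmoothField X) (hc : IsCompleteField X) (s t : ℝ) (p : M) :
    flow X (s + t) p = flow X s (flow X t p) := by
  have h := flow_eq_of_isMIntegralCurve hX hc ((isMIntegralCurve_flow hc p).comp_add t) s
  simpa using h.symm

/-- The flow of X at time ε is the flow of εX at time 1. In a chart, with the field cut off, the
solutions of u' = ε f(u) on a fixed time interval depend smoothly on (ε, x), and uniqueness of
integral curves identifies their value at time 1 with the flow. -/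
theorem contMDiffAt_flow_zero (hX : IsSmoothField X) (hc : IsCompleteField X) (p : M) :
    ContMDiffAt (𝓘(ℝ, ℝ).prod (𝓡 (2 * n))) (𝓡 (2 * n)) ∞ (fun q : ℝ × M ↦ flow X q.1 q.2)
      (0, p) := by
  set f : Model n → Model n := fun z ↦ coframe p z (X ((coord (n := n) p).symm z)) with hf
  set U := (coord (n := n) p).target with hU
  set z₀ := coord (n := n) p p with hz₀
  have hUo : IsOpen U := isOpen_coord_target p
  have hz₀U : z₀ ∈ U := mem_extChartAt_target p
  obtain ⟨R, hR, hRU⟩ := Metric.nhds_basis_closedBall.mem_iff.1 (hUo.mem_nhds hz₀U)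
  -- The cut-off is 1 on the ball of radius R/2, where the solutions below will stay, and its
  -- support lies in the chart. So `fχ` is smooth on the whole model space.
  let χ : ContDiffBump z₀ := ⟨R / 2, R, half_pos hR, half_lt_self hR⟩
  let fχ : Model n → Model n := fun z ↦ χ z • f z
  have hfχ : ContDiff ℝ ∞ fχ := by
    rw [contDiff_iff_contDiffAt]
    intro z
    by_cases hz : z ∈ U
    · exact χ.contDiff.contDiffAt.smul ((hX p).contDiffAt (hUo.mem_nhds hz))
    · have hz' : z ∉ tsupport χ := fun h ↦ hz (hRU (by rwa [χ.tsupport_eq] at h))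
      have h0 : fχ =ᶠ[𝓝 z] fun _ ↦ 0 := by
        filter_upwards [(isClosed_tsupport χ).isOpen_compl.mem_nhds hz'] with y hy
        simp [fχ, image_eq_zero_of_notMem_tsupport hy]
      exact contDiffAt_const.congr_of_eventuallyEq h0
  obtain ⟨u, hu, hu0, hsol⟩ := exists_smooth_solution fχ hfχ z₀
  have hball : ∀ᶠ q in 𝓝 ((0 : ℝ), z₀), u q ∈ Metric.ball (ContinuousMap.const _ z₀) (R / 2) := by
    refine hu.continuousAt.eventually ?_
    rw [hu0]
    exact Metric.ball_mem_nhds _ (half_pos hR)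
  have hlift : ContMDiffAt (𝓘(ℝ, ℝ).prod (𝓡 (2 * n))) 𝓘(ℝ, ℝ × Model n) ∞
      (fun q : ℝ × M ↦ (q.1, coord (n := n) p q.2)) (0, p) := by
    refine contMDiffAt_fst.prodMk_space ?_
    exact (contMDiffAt_coord p (mem_extChartAt_source p)).comp ((0 : ℝ), p) contMDiffAt_snd
  let e1 : C(TimeInterval, Model n) →L[ℝ] Model n :=
    ContinuousMap.evalCLM ℝ ⟨1, by norm_num, by norm_num⟩
  have hG : ContMDiffAt (𝓘(ℝ, ℝ).prod (𝓡 (2 * n))) 𝓘(ℝ, Model n) ∞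
      (fun q : ℝ × M ↦ e1 (u (q.1, coord (n := n) p q.2))) (0, p) :=
    ContMDiffAt.comp (0, p) (g := fun q ↦ e1 (u q))
      (e1.contDiff.contDiffAt.comp _ hu).contMDiffAt hlift
  have hG0 : e1 (u (0, z₀)) = z₀ := by rw [hu0]; rfl
  have hmain : ContMDiffAt (𝓘(ℝ, ℝ).prod (𝓡 (2 * n))) (𝓡 (2 * n)) ∞
      (fun q : ℝ × M ↦ (coord (n := n) p).symm (e1 (u (q.1, coord (n := n) p q.2)))) (0, p) := by
    refine ContMDiffAt.comp (0, p) (g := (coord (n := n) p).symm) ?_ hG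
    refine (contMDiffOn_coord_symm p).contMDiffAt (hUo.mem_nhds ?_)
    change e1 (u (0, z₀)) ∈ U
    rwa [hG0]
  refine hmain.congr_of_eventuallyEq ?_
  have hsrc : ∀ᶠ q : ℝ × M in 𝓝 (0, p), q.2 ∈ (coord (n := n) p).source :=
    continuousAt_snd.eventually (extChartAt_source_mem_nhds (I := 𝓡 (2 * n)) p)
  filter_upwards [hlift.continuousAt.eventually hball, hlift.continuousAt.eventually hsol, hsrc]
    with q hq1 ⟨hq2, hq3⟩ hq4
  set w := extendTime (u (q.1, coord (n := n) p q.2)) with hw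
  have hwball : ∀ t, w t ∈ Metric.closedBall z₀ (R / 2) := fun t ↦ by
    have := (ContinuousMap.dist_apply_le_dist (f := u (q.1, coord (n := n) p q.2))
      (g := ContinuousMap.const _ z₀) (Set.projIcc (-1) 2 (by norm_num) t)).trans hq1.le
    exact this
  have hwU : ∀ t, w t ∈ U := fun t ↦
    hRU (Metric.closedBall_subset_closedBall (half_le_self hR.le) (hwball t))
  have hcurve : IsMIntegralCurveOn (I := 𝓡 (2 * n)) (fun t ↦ (coord (n := n) p).symm (w t))
      (q.1 • X) (Set.Ioo (-1) 2) := by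
    intro t ht
    have h1 := (mdifferentiableAt_coord_symm p (hwU t)).hasMFDerivAt.comp t
      (hq3 t ht).hasFDerivAt.hasMFDerivAt
    refine (h1.congr_mfderiv ?_).hasMFDerivWithinAt
    have h2 : fχ (w t) = f (w t) := by
      simp only [fχ]
      rw [χ.one_of_mem_closedBall (hwball t), one_smul]
    have h3 : frame p (w t) (q.1 • fχ (w t)) = (q.1 • X) ((coord (n := n) p).symm (w t)) := by
      rw [h2, map_smul, hf, frame_coframe p (hwU t)]
      rfl
    rw [← h3]
    refine ContinuousLinearMap.ext fun r ↦ ?_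
    exact (frame p (w t)).map_smul r (q.1 • fχ (w t))
  -- The rescaled flow line is the second integral curve of `q.1 • X` with the same initial point.
  -- Comparison at t = 1 gives the claim.
  have hcurve' : IsMIntegralCurveOn (I := 𝓡 (2 * n)) (fun t ↦ flow X (t * q.1) q.2)
      (q.1 • X) (Set.Ioo (-1) 2) :=
    ((isMIntegralCurve_flow hc q.2).comp_mul q.1).isMIntegralCurveOn _
  have h0 : (coord (n := n) p).symm (w 0) = flow X (0 * q.1) q.2 := by
    rw [zero_mul, flow_zero_time hc, hq2]
    exact (coord (n := n) p).left_inv hq4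
  have := isMIntegralCurveOn_Ioo_eqOn_of_contMDiff_boundaryless (t₀ := 0) (by norm_num)
    ((hX.smul q.1).contMDiff.of_le (by simp)) hcurve hcurve' h0 (x := 1) (by norm_num)
  simp only [one_mul] at this
  rw [← this, hw]
  exact congrArg _ (extendTime_coe (u (q.1, coord (n := n) p q.2)) ⟨1, by norm_num, by norm_num⟩)

/-- The flow of a complete smooth vector field is smooth jointly in time and space. -/
theorem contMDiff_flow (hX : IsSmoothField X) (hc : IsCompleteField X) :
    ContMDiff (𝓘(ℝ, ℝ).prod (𝓡 (2 * n))) (𝓡 (2 * n)) ∞ (fun q : ℝ × M ↦ flow X q.1 q.2) := by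
  -- For a finite order of differentiability, being of that class at a point is an open condition,
  -- which `hopen` uses.
  rw [contMDiff_infty]
  rintro m ⟨T, p⟩
  set Φ : ℝ × M → M := fun q ↦ flow X q.1 q.2 with hΦ
  -- The good times for the point p form a set that is open, closed and contains 0.
  let S : Set ℝ := {t | ContMDiffAt (𝓘(ℝ, ℝ).prod (𝓡 (2 * n))) (𝓡 (2 * n)) m Φ (t, p)}
  have hopen : ∀ q : ℝ × M, ContMDiffAt (𝓘(ℝ, ℝ).prod (𝓡 (2 * n))) (𝓡 (2 * n)) m Φ q →
      ∀ᶠ q' in 𝓝 q, ContMDiffAt (𝓘(ℝ, ℝ).prod (𝓡 (2 * n))) (𝓡 (2 * n)) m Φ q' := fun q hq ↦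
    (contMDiffAt_iff_contMDiffAt_nhds (by simp)).1 hq
  have hlocal : ∀ y : M, ContMDiffAt (𝓘(ℝ, ℝ).prod (𝓡 (2 * n))) (𝓡 (2 * n)) m Φ (0, y) :=
    fun y ↦ (contMDiffAt_flow_zero hX hc y).of_le (mod_cast le_top)
  have hSo : IsOpen S := by
    rw [isOpen_iff_mem_nhds]
    intro t ht
    exact (Continuous.prodMk_left p).continuousAt.eventually (hopen _ ht)
  have hSc : IsClosed S := by
    rw [← closure_subset_iff_isClosed]
    intro t ht
    have hcont : ContinuousAt (fun s : ℝ ↦ (t - s, Φ (s, p))) t :=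
      (continuousAt_const.sub continuousAt_id).prodMk
        (isMIntegralCurve_flow hc p).continuous.continuousAt
    have hev : ∀ᶠ s in 𝓝 t, ContMDiffAt (𝓘(ℝ, ℝ).prod (𝓡 (2 * n))) (𝓡 (2 * n)) m Φ
        (t - s, Φ (s, p)) := hcont.eventually (by
          simp only [sub_self]
          exact hopen _ (hlocal _))
    -- A good time s close to t, so close that the flow is of class m at (t - s, Φ(s, p)). The group
    -- law then writes Φ near (t, p) as a flow by about t - s after the flow by s.
    obtain ⟨s, hs, hsS⟩ := mem_closure_iff_nhds.1 ht _ hev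
    have hΦs : ContMDiffAt (𝓘(ℝ, ℝ).prod (𝓡 (2 * n))) (𝓡 (2 * n)) m
        (fun q : ℝ × M ↦ Φ (s, q.2)) (t, p) :=
      ContMDiffAt.comp (t, p) (g := Φ) (f := fun q : ℝ × M ↦ (s, q.2)) hsS
        (contMDiffAt_const.prodMk contMDiffAt_snd)
    have hdiff : ContMDiffAt (𝓘(ℝ, ℝ).prod (𝓡 (2 * n))) 𝓘(ℝ, ℝ) m
        (fun q : ℝ × M ↦ q.1 - s) (t, p) := contMDiffAt_fst.sub contMDiffAt_const
    have hcomp := ContMDiffAt.comp (t, p) (g := Φ) (f := fun q : ℝ × M ↦ (q.1 - s, Φ (s, q.2)))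
      hs (hdiff.prodMk hΦs)
    refine hcomp.congr_of_eventuallyEq (.of_forall fun q ↦ ?_)
    change flow X q.1 q.2 = flow X (q.1 - s) (flow X s q.2)
    rw [← flow_add hX hc, sub_add_cancel]
  have huniv : S = Set.univ := IsClopen.eq_univ ⟨hSc, hSo⟩ ⟨0, hlocal p⟩
  exact (Set.eq_univ_iff_forall.1 huniv) T

end Flow

/-! ### Lie derivative of a closed 2-form along a Hamiltonian field, in coordinates. -/

section Calculus

variable {E : Type*} [NormedAddCommGroup E] [NormedSpace ℝ E]

/-- The Lie derivative of a closed 2-form along a Hamiltonian vector field vanishes. -/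
theorem lieDeriv_closed_form_eq_zero {W : E → E →L[ℝ] E →L[ℝ] ℝ} {f : E → E} {H : E → ℝ} {z : E}
    (hW : DifferentiableAt ℝ W z) (hf : DifferentiableAt ℝ f z) (hH : ContDiffAt ℝ 2 H z)
    (hanti : ∀ x a b, W x a b = - W x b a)
    (hclosed : ∀ u v w, fderiv ℝ W z u v w - fderiv ℝ W z v u w + fderiv ℝ W z w u v = 0)
    (hgrad : ∀ᶠ x in 𝓝 z, ∀ a, W x a (f x) = fderiv ℝ H x a) (a b : E) :
    fderiv ℝ W z (f z) a b + W z (fderiv ℝ f z a) b + W z a (fderiv ℝ f z b) = 0 := by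
  have hDanti : ∀ u a b, fderiv ℝ W z u a b = - fderiv ℝ W z u b a := fun u a b ↦ by
    have h1 : HasFDerivAt (fun x ↦ W x a b) (((fderiv ℝ W z).flip a).flip b) z := by
      have := (hW.hasFDerivAt.clm_apply (hasFDerivAt_const a z)).clm_apply (hasFDerivAt_const b z)
      refine this.congr_fderiv ?_
      ext; simp
    have h2 : HasFDerivAt (fun x ↦ W x b a) (((fderiv ℝ W z).flip b).flip a) z := by
      have := (hW.hasFDerivAt.clm_apply (hasFDerivAt_const b z)).clm_apply (hasFDerivAt_const a z)
      refine this.congr_fderiv ?_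
      ext; simp
    have h3 : (fun x ↦ W x a b) = -fun x ↦ W x b a := funext fun x ↦ hanti x a b
    rw [h3] at h1
    exact DFunLike.congr_fun (h1.unique h2.neg) u
  have hdH : DifferentiableAt ℝ (fderiv ℝ H) z :=
    (hH.fderiv_right (m := 1) (by norm_num)).differentiableAt (by simp)
  -- Differentiating W(v, f) = dH(v) in the direction u. Antisymmetrizing in u and v kills the
  -- Hessian of H, and closedness turns what is left into the Lie derivative.
  have hgrad' : ∀ u v, fderiv ℝ W z u v (f z) + W z v (fderiv ℝ f z u)
      = fderiv ℝ (fderiv ℝ H) z u v := fun u v ↦ by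
    have h1 := (hW.hasFDerivAt.clm_apply (hasFDerivAt_const v z)).clm_apply hf.hasFDerivAt
    have h2 := hdH.hasFDerivAt.clm_apply (hasFDerivAt_const v z)
    have h3 : (fun x ↦ W x v (f x)) =ᶠ[𝓝 z] fun x ↦ fderiv ℝ H x v := hgrad.mono fun x hx ↦ hx v
    have h4 := DFunLike.congr_fun ((h1.congr_of_eventuallyEq h3.symm).unique h2) u
    simp at h4
    linarith
  have hsymm : fderiv ℝ (fderiv ℝ H) z a b = fderiv ℝ (fderiv ℝ H) z b a :=
    hH.isSymmSndFDerivAt (by simp) a b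
  have h1 := hgrad' a b
  have h2 := hgrad' b a
  have h3 := hclosed (f z) a b
  have h4 := hDanti a (f z) b
  have h5 := hDanti b (f z) a
  have h6 := hanti z (fderiv ℝ f z a) b
  linarith

/-- A 2-form whose Lie derivative along the generator `f` of a local flow `Φ` vanishes is
infinitesimally preserved by `Φ`. -/
theorem hasDerivAt_pullback_eq_zero {W : E → E →L[ℝ] E →L[ℝ] ℝ} {f : E → E} {Φ : ℝ × E → E} {z : E}
    (hW : DifferentiableAt ℝ W z) (hf : DifferentiableAt ℝ f z) (hΦ : ContDiffAt ℝ 2 Φ (0, z))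
    (hΦ0 : ∀ᶠ x in 𝓝 z, Φ (0, x) = x)
    (hΦf : ∀ᶠ x in 𝓝 z, fderiv ℝ Φ (0, x) (1, 0) = f x) (a b : E)
    (hlie : fderiv ℝ W z (f z) a b + W z (fderiv ℝ f z a) b + W z a (fderiv ℝ f z b) = 0) :
    HasDerivAt (fun t : ℝ ↦ W (Φ (t, z)) (fderiv ℝ Φ (t, z) (0, a)) (fderiv ℝ Φ (t, z) (0, b)))
      0 0 := by
  have hz0 : Φ (0, z) = z := hΦ0.self_of_nhds
  have hΦd : DifferentiableAt ℝ Φ (0, z) := hΦ.differentiableAt (by simp)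
  have hdΦ : DifferentiableAt ℝ (fderiv ℝ Φ) (0, z) :=
    (hΦ.fderiv_right (m := 1) (by norm_num)).differentiableAt (by simp)
  have hsp : ∀ v, fderiv ℝ Φ (0, z) (0, v) = v := fun v ↦ by
    have h1 := hΦd.hasFDerivAt.comp z ((hasFDerivAt_const (0 : ℝ) z).prodMk (hasFDerivAt_id z))
    have h2 : Φ ∘ (fun x ↦ ((0 : ℝ), x)) =ᶠ[𝓝 z] id := hΦ0
    have h3 := DFunLike.congr_fun ((h1.congr_of_eventuallyEq h2.symm).unique (hasFDerivAt_id z)) v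
    simpa using h3
  have hline : HasDerivAt (fun t : ℝ ↦ (t, z)) ((1 : ℝ), (0 : E)) 0 :=
    (hasDerivAt_id (0 : ℝ)).prodMk (hasDerivAt_const (0 : ℝ) z)
  -- Mixed second derivatives commute: the time derivative of the space derivative of Φ is the space
  -- derivative of the generator f.
  have hmix : ∀ v, HasDerivAt (fun t : ℝ ↦ fderiv ℝ Φ (t, z) (0, v)) (fderiv ℝ f z v) 0 := fun v ↦ by
    have h1 := hdΦ.hasFDerivAt.comp_hasDerivAt (0 : ℝ) (f := fun t : ℝ ↦ (t, z)) hline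
    have h2 : HasDerivAt (fun t : ℝ ↦ fderiv ℝ Φ (t, z) (0, v))
        (fderiv ℝ (fderiv ℝ Φ) (0, z) (1, 0) (0, v)) 0 := by
      simpa using h1.clm_apply (hasDerivAt_const (0 : ℝ) ((0 : ℝ), v))
    have h3 : fderiv ℝ (fderiv ℝ Φ) (0, z) (1, 0) (0, v)
        = fderiv ℝ (fderiv ℝ Φ) (0, z) (0, v) (1, 0) :=
      hΦ.isSymmSndFDerivAt (by simp) _ _
    have h4 := (hdΦ.hasFDerivAt.comp z (f := fun x ↦ ((0 : ℝ), x))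
      ((hasFDerivAt_const (0 : ℝ) z).prodMk (hasFDerivAt_id z))).clm_apply
        (hasFDerivAt_const ((1 : ℝ), (0 : E)) z)
    have h5 : (fun x ↦ fderiv ℝ Φ (0, x) (1, 0)) =ᶠ[𝓝 z] f := hΦf
    have h6 := DFunLike.congr_fun
      ((h4.congr_of_eventuallyEq h5.symm).unique hf.hasFDerivAt) v
    have h7 : fderiv ℝ (fderiv ℝ Φ) (0, z) (0, v) (1, 0) = fderiv ℝ f z v := by
      simpa using h6
    rwa [h3, h7] at h2
  have hbase : HasDerivAt (fun t : ℝ ↦ Φ (t, z)) (f z) 0 := by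
    have h1 := hΦd.hasFDerivAt.comp_hasDerivAt (0 : ℝ) (f := fun t : ℝ ↦ (t, z)) hline
    rwa [hΦf.self_of_nhds] at h1
  have hWt : HasDerivAt (fun t : ℝ ↦ W (Φ (t, z))) (fderiv ℝ W z (f z)) 0 := by
    have hW' : HasFDerivAt W (fderiv ℝ W z) (Φ (0, z)) := by
      rw [hz0]
      exact hW.hasFDerivAt
    exact HasFDerivAt.comp_hasDerivAt (E := E →L[ℝ] E →L[ℝ] ℝ) (0 : ℝ) hW' hbase
  have := (hWt.clm_apply (hmix a)).clm_apply (hmix b)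
  refine this.congr_deriv ?_
  simp only [hz0, hsp, add_apply]
  exact hlie

end Calculus

/-! ### The symplectic form and Hamiltonian fields in a chart. -/

section Hamiltonian

variable {n k : ℕ} {M : Type*} [TopologicalSpace M]
  [ChartedSpace (EuclideanSpace ℝ (Fin (2 * n))) M] [IsManifold (𝓡 (2 * n)) ∞ M]

namespace SymplecticForm

variable (Ω : SymplecticForm n M)

/-- The symplectic form in the coordinates of a chart. -/
def coordForm (c : M) (z : Model n) : Model n →L[ℝ] Model n →L[ℝ] ℝ :=
  let B : Model n →L[ℝ] Model n →L[ℝ] ℝ := Ω.toFun ((coord (n := n) c).symm z)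
  let A : Model n →L[ℝ] Model n := frame c z
  B.bilinearComp A A

theorem coordForm_apply (c : M) (z a b : Model n) : Ω.coordForm c z a b =
    Ω.toFun ((coord (n := n) c).symm z) (frame c z a) (frame c z b) := rfl

theorem coordForm_antisymm (c : M) (z a b : Model n) :
    Ω.coordForm c z a b = - Ω.coordForm c z b a := Ω.antisymm _ _ _

theorem contDiffOn_coordForm (c : M) :
    ContDiffOn ℝ ∞ (Ω.coordForm c) (coord (n := n) c).target := by
  refine contDiffOn_clm_apply.2 fun a ↦ contDiffOn_clm_apply.2 fun b ↦ ?_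
  intro z hz
  have hfr : ∀ a : Model n, ContMDiffWithinAt 𝓘(ℝ, Model n) (𝓡 (2 * n)).tangent ∞
      (fun z ↦ (⟨(coord (n := n) c).symm z, frame c z a⟩ : TangentBundle (𝓡 (2 * n)) M))
      (coord (n := n) c).target z := fun a ↦
    contMDiffOn_frame c (f := fun _ ↦ a) contDiffOn_const z hz
  have : ContMDiffWithinAt 𝓘(ℝ, Model n) ((𝓡 (2 * n)).prod 𝓘(ℝ)) ∞
      (fun z ↦ Bundle.TotalSpace.mk' ℝ (E := Bundle.Trivial M ℝ) ((coord (n := n) c).symm z)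
        (Ω.toFun ((coord (n := n) c).symm z) (frame c z a) (frame c z b)))
      (coord (n := n) c).target z := by
    apply ContMDiffWithinAt.clm_bundle_apply₂ (F₁ := Model n) (F₂ := Model n)
    · exact ContMDiffAt.comp_contMDiffWithinAt z Ω.smooth.contMDiffAt
        (contMDiffOn_coord_symm c z hz)
    · exact hfr a
    · exact hfr b
  rw [Bundle.contMDiffWithinAt_totalSpace] at this
  exact contMDiffWithinAt_iff_contDiffWithinAt.1 this.2

theorem coordForm_closed (c : M) {z : Model n} (hz : z ∈ (coord (n := n) c).target)
    (u v w : Model n) : fderiv ℝ (Ω.coordForm c) z u v w - fderiv ℝ (Ω.coordForm c) z v u w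
      + fderiv ℝ (Ω.coordForm c) z w u v = 0 := by
  have hd : DifferentiableAt ℝ (Ω.coordForm c) z :=
    ((Ω.contDiffOn_coordForm c).contDiffAt ((isOpen_coord_target c).mem_nhds hz)).differentiableAt
      (by simp)
  have h : ∀ a b u, fderiv ℝ (fun x ↦ Ω.coordForm c x a b) z u
      = fderiv ℝ (Ω.coordForm c) z u a b := fun a b u ↦ by
    have h1 := (hd.hasFDerivAt.clm_apply (hasFDerivAt_const a z)).clm_apply (hasFDerivAt_const b z)
    rw [h1.fderiv]
    simp
  have := Ω.closed c z hz u v w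
  rw [← h, ← h, ← h]
  exact this

/-- The components in a chart of the differential of a function. -/
theorem diff_frame {F : M → ℝ} (hF : ContMDiff (𝓡 (2 * n)) 𝓘(ℝ, ℝ) ∞ F) (c : M) {z : Model n}
    (hz : z ∈ (coord (n := n) c).target) (a : Model n) :
    diff (n := n) F ((coord (n := n) c).symm z) (frame c z a)
      = fderiv ℝ (F ∘ (coord (n := n) c).symm) z a := by
  have h := mfderiv_comp z (hF.mdifferentiableAt (by simp)) (mdifferentiableAt_coord_symm c hz)
  rw [← mfderiv_eq_fderiv, h]
  rfl

theorem contDiffOn_coord_function {F : M → ℝ} (hF : ContMDiff (𝓡 (2 * n)) 𝓘(ℝ, ℝ) ∞ F) (c : M) :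
    ContDiffOn ℝ ∞ (F ∘ (coord (n := n) c).symm) (coord (n := n) c).target :=
  contMDiffOn_iff_contDiffOn.1 (hF.comp_contMDiffOn (contMDiffOn_coord_symm c))

theorem toFun_hamField (F : M → ℝ) (m : M) (x : TangentSpace (𝓡 (2 * n)) m) :
    Ω.toFun m x (Ω.hamField F m) = diff F m x := Ω.apply_J m _ x

/-- In coordinates the field solves a linear system whose operator depends smoothly on the point and
is invertible by nondegeneracy, and inversion of operators is smooth. -/
theorem isSmoothField_hamField {F : M → ℝ} (hF : ContMDiff (𝓡 (2 * n)) 𝓘(ℝ, ℝ) ∞ F) :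
    IsSmoothField (Ω.hamField F) := by
  refine .of_frame fun c ↦ ?_
  -- The form is flipped because the Hamiltonian field occupies its second slot.
  let A : Model n → Model n →L[ℝ] (Model n →L[ℝ] ℝ) := fun z ↦ (Ω.coordForm c z).flip
  have hA : ∀ z ∈ (coord (n := n) c).target, ∃ e : Model n ≃L[ℝ] (Model n →L[ℝ] ℝ),
      (e : Model n →L[ℝ] (Model n →L[ℝ] ℝ)) = A z := by
    intro z hz
    have hinj : Function.Injective (A z).toLinearMap := by
      rw [injective_iff_map_eq_zero]
      intro y hy
      have h0 : frame c z y = 0 := Ω.nondegenerate _ _ fun x ↦ by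
        rw [← frame_coframe c hz x]
        exact DFunLike.congr_fun hy (coframe c z x)
      rw [← coframe_frame c hz y, h0, map_zero]
    have hfin : Module.finrank ℝ (Model n) = Module.finrank ℝ (Model n →L[ℝ] ℝ) := by
      rw [← (LinearMap.toContinuousLinearMap (𝕜 := ℝ) (E := Model n) (F' := ℝ)).finrank_eq]
      exact Subspace.dual_finrank_eq.symm
    exact ⟨(LinearMap.linearEquivOfInjective (A z).toLinearMap hinj hfin).toContinuousLinearEquiv,
      by ext; rfl⟩
  have hAs : ContDiffOn ℝ ∞ A (coord (n := n) c).target :=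
    contDiffOn_clm_apply.2 fun a ↦ contDiffOn_clm_apply.2 fun b ↦
      ((Ω.contDiffOn_coordForm c).clm_apply (contDiffOn_const (c := b))).clm_apply
        (contDiffOn_const (c := a))
  have hdF : ContDiffOn ℝ ∞ (fderiv ℝ (F ∘ (coord (n := n) c).symm)) (coord (n := n) c).target :=
    (contDiffOn_coord_function hF c).fderiv_of_isOpen (isOpen_coord_target c) (by simp)
  refine ⟨fun z ↦ (A z).inverse (fderiv ℝ (F ∘ (coord (n := n) c).symm) z), ?_, ?_⟩
  · refine ContDiffOn.clm_apply (fun z hz ↦ ?_) hdF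
    obtain ⟨e, he⟩ := hA z hz
    have h1 : ContDiffAt ℝ ∞ ContinuousLinearMap.inverse (A z) := he ▸ contDiffAt_map_inverse e
    exact h1.comp_contDiffWithinAt z (hAs z hz)
  · intro z hz
    obtain ⟨e, he⟩ := hA z hz
    set f := (A z).inverse (fderiv ℝ (F ∘ (coord (n := n) c).symm) z) with hf
    have h1 : A z f = fderiv ℝ (F ∘ (coord (n := n) c).symm) z := by
      rw [hf, ← he, ContinuousLinearMap.inverse_equiv]
      exact e.apply_symm_apply _
    refine sub_eq_zero.1 (Ω.nondegenerate _ _ fun x ↦ ?_)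
    rw [map_sub, toFun_hamField, ← frame_coframe c hz x, diff_frame hF c hz, ← h1, sub_eq_zero]
    rfl

end SymplecticForm

end Hamiltonian

/-! ### Velocities of curves and derivatives of self-maps. -/

section Velocity

variable {n : ℕ} {M : Type*} [TopologicalSpace M]
  [ChartedSpace (EuclideanSpace ℝ (Fin (2 * n))) M]

/-- The derivative of a self-map, with all tangent spaces identified with the model space. -/
def der (g : M → M) (p : M) : Model n →L[ℝ] Model n := mfderiv (𝓡 (2 * n)) (𝓡 (2 * n)) g p

theorem der_comp {g h : M → M} {p : M}
    (hg : MDifferentiableAt (𝓡 (2 * n)) (𝓡 (2 * n)) g (h p))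
    (hh : MDifferentiableAt (𝓡 (2 * n)) (𝓡 (2 * n)) h p) (v : Model n) :
    der (n := n) (fun x ↦ g (h x)) p v = der (n := n) g (h p) (der (n := n) h p v) :=
  DFunLike.congr_fun (mfderiv_comp p hg hh) v

theorem der_id (p : M) (v : Model n) : der (n := n) (fun x : M ↦ x) p v = v :=
  DFunLike.congr_fun (mfderiv_id (I := 𝓡 (2 * n)) (x := p)) v

/-- `v` is the velocity of the curve `γ` at time `t`. -/
def HasVelocity (γ : ℝ → M) (t : ℝ) (v : Model n) : Prop :=
  HasMFDerivAt 𝓘(ℝ, ℝ) (𝓡 (2 * n)) γ t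
    ((ContinuousLinearMap.smulRight (1 : ℝ →L[ℝ] ℝ) v : ℝ →L[ℝ] Model n))

theorem HasVelocity.unique {γ : ℝ → M} {t : ℝ} {v w : Model n} (hv : HasVelocity γ t v)
    (hw : HasVelocity γ t w) : v = w := by
  have := DFunLike.congr_fun (hasMFDerivAt_unique hv hw) (1 : ℝ)
  have h1 : ∀ v : Model n, (ContinuousLinearMap.smulRight (1 : ℝ →L[ℝ] ℝ) v : ℝ →L[ℝ] Model n) 1
      = v := fun v ↦ by simp
  rw [← h1 v, ← h1 w]
  exact this

theorem HasVelocity.comp {γ : ℝ → M} {t : ℝ} {v : Model n} (hv : HasVelocity γ t v) {g : M → M}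
    (hg : MDifferentiableAt (𝓡 (2 * n)) (𝓡 (2 * n)) g (γ t)) :
    HasVelocity (fun s ↦ g (γ s)) t (der (n := n) g (γ t) v) := by
  refine (hg.hasMFDerivAt.comp t hv).congr_mfderiv ?_
  refine ContinuousLinearMap.ext fun r ↦ ?_
  exact (der (n := n) g (γ t)).map_smul r v

theorem HasVelocity.hasDerivAt {γ : ℝ → M} {t : ℝ} {v : Model n} (hv : HasVelocity γ t v)
    {E : Type*} [NormedAddCommGroup E] [NormedSpace ℝ E] {F : M → E}
    (hF : MDifferentiableAt (𝓡 (2 * n)) 𝓘(ℝ, E) F (γ t)) :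
    HasDerivAt (fun s ↦ F (γ s))
      ((mfderiv (𝓡 (2 * n)) 𝓘(ℝ, E) F (γ t) : Model n →L[ℝ] E) v) t := by
  let L : Model n →L[ℝ] E := mfderiv (𝓡 (2 * n)) 𝓘(ℝ, E) F (γ t)
  have h : HasFDerivAt (fun s ↦ F (γ s))
      (L.comp (ContinuousLinearMap.smulRight (1 : ℝ →L[ℝ] ℝ) v)) t :=
    (hF.hasMFDerivAt.comp t hv).hasFDerivAt
  refine h.hasDerivAt.congr_deriv ?_
  change L ((1 : ℝ) • v) = L v
  rw [one_smul]

end Velocity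

/-! ### The derivative of the flow and its expression in a chart. -/

section FlowDerivative

variable {n : ℕ} {M : Type*} [TopologicalSpace M] [T2Space M]
  [ChartedSpace (EuclideanSpace ℝ (Fin (2 * n))) M] [IsManifold (𝓡 (2 * n)) ∞ M]
  {X : ∀ m : M, TangentSpace (𝓡 (2 * n)) m}

omit [T2Space M] [IsManifold (𝓡 (2 * n)) ∞ M] in
theorem hasVelocity_flow (hc : IsCompleteField X) (p : M) (t : ℝ) :
    HasVelocity (fun s ↦ flow X s p) t (X (flow X t p)) := isMIntegralCurve_flow hc p t

omit [T2Space M] [IsManifold (𝓡 (2 * n)) ∞ M] in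
theorem hasVelocity_flow_zero (hc : IsCompleteField X) (p : M) :
    HasVelocity (n := n) (fun s ↦ flow X s p) 0 (X p) := by
  have h := hasVelocity_flow hc p 0
  -- A copy of the field with constant codomain, so that the base point can be rewritten.
  let Y : M → Model n := X
  have hY : Y (flow X 0 p) = Y p := by rw [flow_zero_time hc]
  change HasVelocity (fun s ↦ flow X s p) 0 (Y (flow X 0 p)) at h
  rwa [hY] at h

theorem contMDiff_flow_time (hX : IsSmoothField X) (hc : IsCompleteField X) (t : ℝ) :
    ContMDiff (𝓡 (2 * n)) (𝓡 (2 * n)) ∞ (flow X t) :=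
  (contMDiff_flow hX hc).comp (contMDiff_const.prodMk contMDiff_id)

theorem mdifferentiableAt_flow_time (hX : IsSmoothField X) (hc : IsCompleteField X) (t : ℝ)
    (p : M) : MDifferentiableAt (𝓡 (2 * n)) (𝓡 (2 * n)) (flow X t) p :=
  (contMDiff_flow_time hX hc t).mdifferentiableAt (by simp)

theorem der_flow_add (hX : IsSmoothField X) (hc : IsCompleteField X) (s t : ℝ) (p : M)
    (v : Model n) : der (n := n) (flow X (s + t)) p v
      = der (n := n) (flow X s) (flow X t p) (der (n := n) (flow X t) p v) := by
  rw [show flow X (s + t) = fun x ↦ flow X s (flow X t x) from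
    funext fun x ↦ flow_add hX hc s t x]
  exact der_comp (mdifferentiableAt_flow_time hX hc s _) (mdifferentiableAt_flow_time hX hc t p) v

omit [T2Space M] [IsManifold (𝓡 (2 * n)) ∞ M] in
theorem der_flow_zero (hc : IsCompleteField X) (p : M) (v : Model n) :
    der (n := n) (flow X 0) p v = v := by
  rw [show flow X 0 = fun x ↦ x from funext fun x ↦ flow_zero_time hc x]
  exact der_id p v

theorem der_flow_surjective (hX : IsSmoothField X) (hc : IsCompleteField X) (t : ℝ) (p : M) :
    Function.Surjective (der (n := n) (flow X t) p) := by
  have hinj : Function.Injective (der (n := n) (flow X t) p).toLinearMap :=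
    Function.LeftInverse.injective (g := der (n := n) (flow X (-t)) (flow X t p)) fun v ↦ by
      have := der_flow_add hX hc (-t) t p v
      rw [neg_add_cancel, der_flow_zero hc] at this
      exact this.symm
  exact LinearMap.injective_iff_surjective.1 hinj

/-- The local flow in the coordinates of a chart, with its basic properties. -/
theorem exists_coord_flow (hX : IsSmoothField X) (hc : IsCompleteField X) (p : M) :
    ∃ Φ : ℝ × Model n → Model n, ContDiffAt ℝ ∞ Φ (0, coord (n := n) p p) ∧
      (∀ᶠ z in 𝓝 (coord (n := n) p p), Φ (0, z) = z) ∧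
      (∀ᶠ z in 𝓝 (coord (n := n) p p), fderiv ℝ Φ (0, z) (1, 0)
        = coframe p z (X ((coord (n := n) p).symm z))) ∧
      ∀ᶠ t in 𝓝 (0 : ℝ), (coord (n := n) p).symm (Φ (t, coord (n := n) p p)) = flow X t p ∧
        ∀ a : Model n, der (n := n) (flow X t) p (frame p (coord (n := n) p p) a) =
          frame p (Φ (t, coord (n := n) p p)) (fderiv ℝ Φ (t, coord (n := n) p p) (0, a)) := by
  set z₀ := coord (n := n) p p with hz₀
  have hUo := isOpen_coord_target (n := n) p
  have hz₀U : z₀ ∈ (coord (n := n) p).target := mem_extChartAt_target p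
  have hp : (coord (n := n) p).symm z₀ = p := extChartAt_to_inv p
  let Ψ : ℝ × Model n → M := fun q ↦ flow X q.1 ((coord (n := n) p).symm q.2)
  let Φ : ℝ × Model n → Model n := fun q ↦ coord (n := n) p (Ψ q)
  have hΨ0 : Ψ (0, z₀) = p := (flow_zero_time hc _).trans hp
  have hΨ : ContMDiffAt 𝓘(ℝ, ℝ × Model n) (𝓡 (2 * n)) ∞ Ψ (0, z₀) := by
    have h1 : ContMDiffAt 𝓘(ℝ, ℝ × Model n) (𝓡 (2 * n)) ∞
        (fun q : ℝ × Model n ↦ (coord (n := n) p).symm q.2) (0, z₀) :=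
      ContMDiffAt.comp (0, z₀) (g := (coord (n := n) p).symm)
        ((contMDiffOn_coord_symm p).contMDiffAt (hUo.mem_nhds hz₀U))
        contDiff_snd.contMDiff.contMDiffAt
    have h2 : ContMDiffAt 𝓘(ℝ, ℝ × Model n) 𝓘(ℝ, ℝ) ∞ (fun q : ℝ × Model n ↦ q.1) (0, z₀) :=
      contDiff_fst.contMDiff.contMDiffAt
    exact (contMDiff_flow hX hc).contMDiffAt.comp (0, z₀) (h2.prodMk h1)
  have hΦ : ContDiffAt ℝ ∞ Φ (0, z₀) := by
    refine contMDiffAt_iff_contDiffAt.1 (ContMDiffAt.comp (0, z₀) (g := coord (n := n) p) ?_ hΨ)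
    rw [hΨ0]
    exact contMDiffAt_coord p (mem_extChartAt_source p)
  have hΦd : ∀ᶠ q in 𝓝 ((0 : ℝ), z₀), DifferentiableAt ℝ Φ q :=
    ((hΦ.of_le (m := 1) (by simp)).eventually (by simp)).mono fun q hq ↦
      hq.differentiableAt (by simp)
  have hsrc : ∀ᶠ q in 𝓝 ((0 : ℝ), z₀), Ψ q ∈ (coord (n := n) p).source := by
    refine hΨ.continuousAt.eventually ?_
    rw [hΨ0]
    exact extChartAt_source_mem_nhds (I := 𝓡 (2 * n)) p
  refine ⟨Φ, hΦ, ?_, ?_, ?_⟩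
  · filter_upwards [hUo.mem_nhds hz₀U] with z hz
    change coord (n := n) p (flow X 0 _) = z
    rw [flow_zero_time hc]
    exact (coord (n := n) p).right_inv hz
  · have h1 : ∀ᶠ z in 𝓝 z₀, DifferentiableAt ℝ Φ (0, z) :=
      (Continuous.prodMk_right (0 : ℝ)).continuousAt.eventually hΦd
    filter_upwards [hUo.mem_nhds hz₀U, h1] with z hz hzd
    have h2 : HasDerivAt (fun t : ℝ ↦ Φ (t, z)) (fderiv ℝ Φ (0, z) (1, 0)) 0 :=
      hzd.hasFDerivAt.comp_hasDerivAt (0 : ℝ) (f := fun t : ℝ ↦ (t, z))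
        ((hasDerivAt_id (0 : ℝ)).prodMk (hasDerivAt_const (0 : ℝ) z))
    have h3 := (hasVelocity_flow_zero hc ((coord (n := n) p).symm z)).hasDerivAt
      (F := coord (n := n) p) (by
        rw [flow_zero_time hc]
        exact (contMDiffAt_coord p ((coord (n := n) p).map_target hz)).mdifferentiableAt (by simp))
    have h4 := h2.unique h3
    rw [flow_zero_time hc] at h4
    exact h4
  · have h1 : ∀ᶠ t in 𝓝 (0 : ℝ), DifferentiableAt ℝ Φ (t, z₀) :=
      (Continuous.prodMk_left z₀).continuousAt.eventually hΦd
    -- A whole neighbourhood of (t, z₀) must stay in the chart domain, since the derivative in z is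
    -- taken at a fixed nonzero t.
    have h2 : ∀ᶠ t in 𝓝 (0 : ℝ), ∀ᶠ q in 𝓝 (t, z₀), Ψ q ∈ (coord (n := n) p).source :=
      (Continuous.prodMk_left z₀).continuousAt.eventually hsrc.eventually_nhds
    filter_upwards [h1, h2] with t ht1 ht2
    have ht3 : Ψ (t, z₀) ∈ (coord (n := n) p).source := ht2.self_of_nhds
    have ht4 : Φ (t, z₀) ∈ (coord (n := n) p).target := (coord (n := n) p).map_source ht3
    have hinv : (coord (n := n) p).symm (Φ (t, z₀)) = Ψ (t, z₀) := (coord (n := n) p).left_inv ht3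
    refine ⟨hinv.trans (by simp only [Ψ, hp]), fun a ↦ ?_⟩
    have h3 : HasFDerivAt (fun z ↦ Φ (t, z)) ((fderiv ℝ Φ (t, z₀)).comp
        (ContinuousLinearMap.inr ℝ ℝ (Model n))) z₀ :=
      ht1.hasFDerivAt.comp z₀ (hasFDerivAt_prodMk_right t z₀)
    have h4 := (mdifferentiableAt_coord_symm p ht4).hasMFDerivAt.comp z₀ h3.hasMFDerivAt
    have h5 := (mdifferentiableAt_flow_time hX hc t ((coord (n := n) p).symm z₀)).hasMFDerivAt.comp z₀
      (mdifferentiableAt_coord_symm p hz₀U).hasMFDerivAt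
    have h6 : (flow X t ∘ (coord (n := n) p).symm)
        =ᶠ[𝓝 z₀] ((coord (n := n) p).symm ∘ fun z ↦ Φ (t, z)) := by
      filter_upwards [(Continuous.prodMk_right t).continuousAt.eventually ht2] with z hz
      exact ((coord (n := n) p).left_inv hz).symm
    have h7 := DFunLike.congr_fun (hasMFDerivAt_unique (h5.congr_of_eventuallyEq h6.symm) h4) a
    have h8 : der (n := n) (flow X t) ((coord (n := n) p).symm z₀) (frame p z₀ a)
        = frame p (Φ (t, z₀)) (fderiv ℝ Φ (t, z₀) (0, a)) := h7
    rwa [hp] at h8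

end FlowDerivative

/-! ### Hamiltonian flows are symplectic, and commute for functions in involution. -/

section HamiltonianFlow

variable {n : ℕ} {M : Type*} [TopologicalSpace M] [T2Space M]
  [ChartedSpace (EuclideanSpace ℝ (Fin (2 * n))) M] [IsManifold (𝓡 (2 * n)) ∞ M]

namespace SymplecticForm

variable (Ω : SymplecticForm n M)

/-- The symplectic form, with all tangent spaces identified with the model space. -/
def form (p : M) : Model n →L[ℝ] Model n →L[ℝ] ℝ := Ω.toFun p

/-- The Hamiltonian vector field, with all tangent spaces identified with the model space. -/
def ham (F : M → ℝ) (p : M) : Model n := Ω.hamField F p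

omit [T2Space M] in
theorem form_ham (F : M → ℝ) (p : M) (v : Model n) :
    Ω.form p v (Ω.ham F p) = diff (n := n) F p v := Ω.toFun_hamField F p v

omit [T2Space M] in
theorem eq_of_form_eq (p : M) {v w : Model n} (h : ∀ x, Ω.form p x v = Ω.form p x w) : v = w := by
  have h0 : ∀ x, Ω.form p x (v - w) = 0 := fun x ↦ by rw [map_sub, h, sub_self]
  exact sub_eq_zero.1 (Ω.nondegenerate p (v - w) h0)

variable {F G : M → ℝ} (hF : ContMDiff (𝓡 (2 * n)) 𝓘(ℝ, ℝ) ∞ F)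
  (hc : IsCompleteField (Ω.hamField F)) (hG : ContMDiff (𝓡 (2 * n)) 𝓘(ℝ, ℝ) ∞ G)
  (hcG : IsCompleteField (Ω.hamField G))

include hF hc

/-- The infinitesimal form of invariance. Only times near 0 matter, so the chart at p suffices, and
there the Lie derivative of the form along the field vanishes. -/
theorem hasDerivAt_form_hamFlow_zero (p : M) (v w : Model n) :
    HasDerivAt (fun t ↦ Ω.form (Ω.hamFlow F t p) (der (n := n) (Ω.hamFlow F t) p v)
      (der (n := n) (Ω.hamFlow F t) p w)) 0 0 := by
  have hX := Ω.isSmoothField_hamField hF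
  obtain ⟨Φ, hΦ, hΦ0, hΦf, hΦt⟩ := exists_coord_flow hX hc p
  set z₀ := coord (n := n) p p with hz₀
  set f : Model n → Model n := fun z ↦ coframe p z (Ω.hamField F ((coord (n := n) p).symm z))
    with hf
  have hUo := isOpen_coord_target (n := n) p
  have hz₀U : z₀ ∈ (coord (n := n) p).target := mem_extChartAt_target p
  have hp : (coord (n := n) p).symm z₀ = p := extChartAt_to_inv p
  have hW : DifferentiableAt ℝ (Ω.coordForm p) z₀ :=
    ((Ω.contDiffOn_coordForm p).contDiffAt (hUo.mem_nhds hz₀U)).differentiableAt (by simp)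
  have hfd : DifferentiableAt ℝ f z₀ :=
    ((hX p).contDiffAt (hUo.mem_nhds hz₀U)).differentiableAt (by simp)
  have hH : ContDiffAt ℝ 2 (F ∘ (coord (n := n) p).symm) z₀ :=
    contDiffAt_infty.1 ((contDiffOn_coord_function hF p).contDiffAt (hUo.mem_nhds hz₀U)) 2
  have hgrad : ∀ᶠ x in 𝓝 z₀, ∀ a, Ω.coordForm p x a (f x)
      = fderiv ℝ (F ∘ (coord (n := n) p).symm) x a := by
    filter_upwards [hUo.mem_nhds hz₀U] with x hx a
    rw [← diff_frame hF p hx, coordForm_apply, hf, frame_coframe p hx, toFun_hamField]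
  have hv : ∀ v : Model n, ∃ a, frame p z₀ a = v := fun v ↦ ⟨_, frame_coframe p hz₀U v⟩
  obtain ⟨a, rfl⟩ := hv v
  obtain ⟨b, rfl⟩ := hv w
  have hlie := lieDeriv_closed_form_eq_zero hW hfd hH (Ω.coordForm_antisymm p)
    (Ω.coordForm_closed p hz₀U) hgrad a b
  refine (hasDerivAt_pullback_eq_zero hW hfd (contDiffAt_infty.1 hΦ 2) hΦ0 hΦf a b
    hlie).congr_of_eventuallyEq ?_
  filter_upwards [hΦt] with t ⟨ht1, ht2⟩
  change Ω.form (flow (Ω.hamField F) t p) (der (n := n) (flow (Ω.hamField F) t) p (frame p z₀ a))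
    (der (n := n) (flow (Ω.hamField F) t) p (frame p z₀ b)) = _
  rw [ht2 a, ht2 b, ← ht1]
  rfl

/-- Hamiltonian flows preserve the symplectic form. -/
theorem form_hamFlow (t : ℝ) (p : M) (v w : Model n) :
    Ω.form (Ω.hamFlow F t p) (der (n := n) (Ω.hamFlow F t) p v) (der (n := n) (Ω.hamFlow F t) p w)
      = Ω.form p v w := by
  have hX := Ω.isSmoothField_hamField hF
  set W : ℝ → ℝ := fun t ↦ Ω.form (Ω.hamFlow F t p) (der (n := n) (Ω.hamFlow F t) p v)
    (der (n := n) (Ω.hamFlow F t) p w) with hW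
  have hd : ∀ t, HasDerivAt W 0 t := fun t ↦ by
    -- By the group law, the derivative at time t is the derivative at time 0 for the point and the
    -- vectors already moved by time t.
    have h := Ω.hasDerivAt_form_hamFlow_zero hF hc (Ω.hamFlow F t p)
      (der (n := n) (Ω.hamFlow F t) p v) (der (n := n) (Ω.hamFlow F t) p w)
    have h1 : HasDerivAt (fun r ↦ Ω.form (Ω.hamFlow F r (Ω.hamFlow F t p))
        (der (n := n) (Ω.hamFlow F r) (Ω.hamFlow F t p) (der (n := n) (Ω.hamFlow F t) p v))
        (der (n := n) (Ω.hamFlow F r) (Ω.hamFlow F t p) (der (n := n) (Ω.hamFlow F t) p w)))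
        0 (t - t) := by rwa [sub_self]
    have h2 := h1.comp_sub_const t t
    refine h2.congr_of_eventuallyEq (.of_forall fun s ↦ ?_)
    simp only [hW, hamFlow]
    rw [← der_flow_add hX hc, ← der_flow_add hX hc, ← flow_add hX hc, sub_add_cancel]
  have h := is_const_of_deriv_eq_zero (fun t ↦ (hd t).differentiableAt) (fun t ↦ (hd t).deriv) t 0
  refine h.trans ?_
  simp only [hW, hamFlow]
  rw [der_flow_zero hc, der_flow_zero hc, flow_zero_time hc]

include hG

omit [T2Space M] hF in
/-- A function in involution with the Hamiltonian is a first integral. -/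
theorem apply_hamFlow_of_poisson_eq_zero (hFG : ∀ m, Ω.poisson F G m = 0) (t : ℝ) (p : M) :
    G (Ω.hamFlow F t p) = G p := by
  have hd : ∀ t, HasDerivAt (fun s ↦ G (flow (Ω.hamField F) s p)) 0 t := fun t ↦ by
    have h := (hasVelocity_flow hc p t).hasDerivAt (hG.mdifferentiableAt (by simp))
    refine h.congr_deriv ?_
    have h1 := hFG (flow (Ω.hamField F) t p)
    rw [poisson, toFun_hamField] at h1
    exact h1
  have h := is_const_of_deriv_eq_zero (fun t ↦ (hd t).differentiableAt) (fun t ↦ (hd t).deriv) t 0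
  exact h.trans (congrArg G (flow_zero_time hc p))

/-- A Hamiltonian flow preserves the Hamiltonian vector fields of the first integrals. -/
theorem der_hamFlow_ham (hFG : ∀ m, Ω.poisson F G m = 0) (t : ℝ) (p : M) :
    der (n := n) (Ω.hamFlow F t) p (Ω.ham G p) = Ω.ham G (Ω.hamFlow F t p) := by
  have hX := Ω.isSmoothField_hamField hF
  -- By nondegeneracy it is enough to pair both sides with images of vectors under the flow. As the
  -- flow preserves both the form and G, each pairing is dG of the original vector.
  refine Ω.eq_of_form_eq (Ω.hamFlow F t p) fun x ↦ ?_
  obtain ⟨y, rfl⟩ := der_flow_surjective hX hc t p x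
  change Ω.form (Ω.hamFlow F t p) (der (n := n) (Ω.hamFlow F t) p y) _
    = Ω.form _ (der (n := n) (Ω.hamFlow F t) p y) _
  rw [Ω.form_hamFlow hF hc, form_ham, form_ham]
  have h1 : (fun x ↦ G (Ω.hamFlow F t x)) = G :=
    funext (Ω.apply_hamFlow_of_poisson_eq_zero hc hG hFG t)
  have h2 := mfderiv_comp p (hG.mdifferentiableAt (by simp))
    (mdifferentiableAt_flow_time hX hc t p)
  have h3 : (mfderiv (𝓡 (2 * n)) 𝓘(ℝ, ℝ) (fun x ↦ G (Ω.hamFlow F t x)) p : Model n →L[ℝ] ℝ) y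
    = diff (n := n) G (Ω.hamFlow F t p) (der (n := n) (Ω.hamFlow F t) p y) :=
      DFunLike.congr_fun h2 y
  rw [h1] at h3
  exact h3

include hcG

/-- The Hamiltonian flows of functions in involution commute. -/
theorem hamFlow_comm (hFG : ∀ m, Ω.poisson F G m = 0) (s t : ℝ) (p : M) :
    Ω.hamFlow F s (Ω.hamFlow G t p) = Ω.hamFlow G t (Ω.hamFlow F s p) := by
  -- The flow of F preserves the field of G, so it maps integral curves of that field to integral
  -- curves.
  have hcurve : IsMIntegralCurve (I := 𝓡 (2 * n))
      (fun r ↦ Ω.hamFlow F s (Ω.hamFlow G r p)) (Ω.hamField G) := fun r ↦ by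
    have h := (hasVelocity_flow hcG p r).comp
      (mdifferentiableAt_flow_time (Ω.isSmoothField_hamField hF) hc s _)
    have h2 := Ω.der_hamFlow_ham hF hc hG hFG s (Ω.hamFlow G r p)
    have h3 : HasVelocity (fun r ↦ Ω.hamFlow F s (Ω.hamFlow G r p)) r
      (der (n := n) (Ω.hamFlow F s) (Ω.hamFlow G r p) (Ω.ham G (Ω.hamFlow G r p))) := h
    rw [h2] at h3
    exact h3
  have h := flow_eq_of_isMIntegralCurve (Ω.isSmoothField_hamField hG) hcG hcurve t
  have h0 : Ω.hamFlow G 0 p = p := flow_zero_time hcG p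
  rw [← h]
  simp only [h0]
  rfl

end SymplecticForm

end HamiltonianFlow

/-! ### Complexified forms and the modification (N ∩ L^⊥) + L. -/

section ComplexLinearAlgebra

variable {V W : Type*} [AddCommGroup V] [Module ℝ V] [AddCommGroup W] [Module ℝ W]

theorem exists_eq_re_add_im (x : Cx V) : ∃ a b : V, x = (1 : ℂ) ⊗ₜ[ℝ] a + Complex.I ⊗ₜ[ℝ] b := by
  induction x using TensorProduct.induction_on with
  | zero => exact ⟨0, 0, by simp⟩
  | tmul z v =>
    refine ⟨z.re • v, z.im • v, ?_⟩
    rw [← TensorProduct.smul_tmul, ← TensorProduct.smul_tmul, ← TensorProduct.add_tmul]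
    congr 1
    simp [Complex.re_add_im]
  | add x y hx hy =>
    obtain ⟨a, b, rfl⟩ := hx
    obtain ⟨c, d, rfl⟩ := hy
    exact ⟨a + c, b + d, by simp only [TensorProduct.tmul_add]; abel⟩

theorem conj_tmul (z : ℂ) (v : V) : conj V (z ⊗ₜ v) = (starRingEnd ℂ z) ⊗ₜ v := rfl

theorem conj_baseChange (f : V →ₗ[ℝ] W) (x : Cx V) :
    conj W (f.baseChange ℂ x) = f.baseChange ℂ (conj V x) := by
  induction x using TensorProduct.induction_on with
  | zero => simp
  | tmul z v => simp [conj_tmul]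
  | add x y hx hy => simp only [map_add, hx, hy]

theorem conj_mem_baseChange (P : Submodule ℝ V) {x : Cx V} (hx : x ∈ P.baseChange ℂ) :
    conj V x ∈ P.baseChange ℂ := by
  obtain ⟨y, hy⟩ := P.toBaseChange_surjective ℂ ⟨x, hx⟩
  have h : ∀ y, conj V (P.toBaseChange ℂ y : Cx V) ∈ P.baseChange ℂ := fun y ↦ by
    induction y using TensorProduct.induction_on with
    | zero => simp
    | tmul z v => exact Submodule.tmul_mem_baseChange_of_mem _ v.2
    | add x y hx hy =>
      rw [map_add, Submodule.coe_add, map_add]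
      exact add_mem hx hy
  have h' := h y
  rwa [hy] at h'

variable (B : LinearMap.BilinForm ℝ V)

theorem baseChange_form_baseChange {B : LinearMap.BilinForm ℝ V} {B' : LinearMap.BilinForm ℝ W}
    {f : V →ₗ[ℝ] W} (hf : ∀ x y, B' (f x) (f y) = B x y) (x y : Cx V) :
    B'.baseChange ℂ (f.baseChange ℂ x) (f.baseChange ℂ y) = B.baseChange ℂ x y := by
  induction x using TensorProduct.induction_on with
  | zero => simp
  | add x x' hx hx' => simp only [map_add, LinearMap.add_apply, hx, hx']
  | tmul z v =>
    induction y using TensorProduct.induction_on with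
    | zero => simp
    | add y y' hy hy' => simp only [map_add, hy, hy']
    | tmul w u => simp [hf]

variable {B}

theorem baseChange_form_antisymm (hB : ∀ x y, B x y = - B y x) (x y : Cx V) :
    B.baseChange ℂ x y = - B.baseChange ℂ y x := by
  induction x using TensorProduct.induction_on with
  | zero => simp
  | add x x' hx hx' => simp only [map_add, LinearMap.add_apply, hx, hx']; ring
  | tmul z v =>
    induction y using TensorProduct.induction_on with
    | zero => simp
    | add y y' hy hy' => simp only [map_add, LinearMap.add_apply, hy, hy']; ring
    | tmul w u =>
      simp only [LinearMap.BilinForm.baseChange_tmul, hB v u]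
      simp [mul_comm]

/-- Pairing a + ib with real vectors gives the pairings of a and of b as real and imaginary parts.
-/
theorem baseChange_form_nondegenerate (hB : ∀ x y, B x y = - B y x)
    (hnd : ∀ y, (∀ x, B x y = 0) → y = 0) : (B.baseChange ℂ).Nondegenerate := by
  have hr : ∀ y : Cx V, (∀ x, B.baseChange ℂ x y = 0) → y = 0 := by
    intro y hy
    obtain ⟨a, b, rfl⟩ := exists_eq_re_add_im y
    have h : ∀ v, B v a = 0 ∧ B v b = 0 := fun v ↦ by
      have := hy ((1 : ℂ) ⊗ₜ v)
      rw [map_add, LinearMap.BilinForm.baseChange_tmul, LinearMap.BilinForm.baseChange_tmul] at this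
      have h1 := congrArg Complex.re this
      have h2 := congrArg Complex.im this
      simp at h1 h2
      exact ⟨h1, h2⟩
    rw [hnd a fun v ↦ (h v).1, hnd b fun v ↦ (h v).2]
    simp
  refine ⟨fun x hx ↦ hr x fun y ↦ ?_, hr⟩
  rw [baseChange_form_antisymm hB, hx, neg_zero]

theorem baseChange_isotropic {P : Submodule ℝ V} (hP : ∀ x ∈ P, ∀ y ∈ P, B x y = 0) {x y : Cx V}
    (hx : x ∈ P.baseChange ℂ) (hy : y ∈ P.baseChange ℂ) : B.baseChange ℂ x y = 0 := by
  rw [Submodule.baseChange_eq_span] at hx hy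
  refine Submodule.span_induction₂ (p := fun x y _ _ ↦ B.baseChange ℂ x y = 0) ?_ ?_ ?_ ?_ ?_ ?_ ?_
    hx hy
  · rintro _ _ ⟨v, hv, rfl⟩ ⟨w, hw, rfl⟩
    simp [hP v hv w hw]
  all_goals simp +contextual

theorem push_comp {U : Type*} [AddCommGroup U] [Module ℝ U] (g : W →ₗ[ℝ] U) (f : V →ₗ[ℝ] W)
    (N : Submodule ℂ (Cx V)) : push (g.comp f) N = push g (push f N) := by
  rw [push, push, push, LinearMap.baseChange_comp, Submodule.map_comp]

theorem push_id (N : Submodule ℂ (Cx V)) : push (LinearMap.id : V →ₗ[ℝ] V) N = N := by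
  rw [push, LinearMap.baseChange_id, Submodule.map_id]

theorem push_baseChange (f : V →ₗ[ℝ] W) (P : Submodule ℝ V) :
    push f (P.baseChange ℂ) = (P.map f).baseChange ℂ := by
  rw [push, Submodule.baseChange_eq_span, Submodule.baseChange_eq_span, Submodule.map_span]
  congr 1
  ext y
  constructor
  · rintro ⟨_, ⟨v, hv, rfl⟩, rfl⟩
    exact ⟨f v, ⟨v, hv, rfl⟩, by simp⟩
  · rintro ⟨_, ⟨v, hv, rfl⟩, rfl⟩
    exact ⟨(1 : ℂ) ⊗ₜ v, ⟨v, hv, rfl⟩, by simp⟩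

theorem baseChange_injective {f : V →ₗ[ℝ] W} (hf : Function.Injective f) :
    Function.Injective (f.baseChange ℂ) := by
  obtain ⟨g, hg⟩ := LinearMap.exists_leftInverse_of_injective f (LinearMap.ker_eq_bot.2 hf)
  refine Function.LeftInverse.injective (g := g.baseChange ℂ) fun x ↦ ?_
  rw [← LinearMap.comp_apply, ← LinearMap.baseChange_comp, hg, LinearMap.baseChange_id]
  rfl

theorem finrank_push {f : V →ₗ[ℝ] W} (hf : Function.Injective f) (N : Submodule ℂ (Cx V)) :
    Module.finrank ℂ (push f N) = Module.finrank ℂ N :=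
  (Submodule.equivMapOfInjective _ (baseChange_injective hf) N).finrank_eq.symm

/-- An injective map preserves dimension. This upgrades invariance under the generators to equality,
which passes to inverses. -/
theorem push_eq_of_le [FiniteDimensional ℝ V] {f : V →ₗ[ℝ] V} (hf : Function.Injective f)
    {N : Submodule ℂ (Cx V)} (h : push f N ≤ N) : push f N = N :=
  Submodule.eq_of_le_of_finrank_eq h (finrank_push hf N)

/-- The modification `(N ∩ L^⊥) + L` of a subspace `N` by (the complexification `L` of) an
isotropic subspace. -/
def adjoin (B : LinearMap.BilinForm ℝ V) (P : Submodule ℝ V) (N : Submodule ℂ (Cx V)) :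
    Submodule ℂ (Cx V) :=
  N ⊓ (B.baseChange ℂ).orthogonal (P.baseChange ℂ) ⊔ P.baseChange ℂ

theorem le_adjoin (P : Submodule ℝ V) (N : Submodule ℂ (Cx V)) :
    P.baseChange ℂ ≤ adjoin B P N := le_sup_right

theorem adjoin_isotropic (hB : ∀ x y, B x y = - B y x) {P : Submodule ℝ V}
    (hP : ∀ x ∈ P, ∀ y ∈ P, B x y = 0) {N : Submodule ℂ (Cx V)}
    (hN : ∀ x ∈ N, ∀ y ∈ N, B.baseChange ℂ x y = 0) :
    ∀ x ∈ adjoin B P N, ∀ y ∈ adjoin B P N, B.baseChange ℂ x y = 0 := by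
  intro x hx y hy
  obtain ⟨x₁, ⟨hx₁, hx₁'⟩, x₂, hx₂, rfl⟩ := Submodule.mem_sup.1 hx
  obtain ⟨y₁, ⟨hy₁, hy₁'⟩, y₂, hy₂, rfl⟩ := Submodule.mem_sup.1 hy
  have h1 : B.baseChange ℂ x₁ y₂ = 0 := by
    rw [baseChange_form_antisymm hB, hx₁' y₂ hy₂, neg_zero]
  simp only [map_add, LinearMap.add_apply]
  rw [hN x₁ hx₁ y₁ hy₁, h1, hy₁' x₂ hx₂, baseChange_isotropic hP hx₂ hy₂]
  simp

/-- Since N = N^⊥, one has N ∩ L^⊥ = (N + L)^⊥, of dimension 2n - dim(N + L). As L is isotropic,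
this space meets L in N ∩ L. So the sum with L has dimension 2n - dim(N + L) + dim L - dim(N ∩ L) =
2n - dim N = n. -/
theorem finrank_adjoin [FiniteDimensional ℝ V] {n : ℕ} (hV : Module.finrank ℝ V = 2 * n) (hB : ∀ x y, B x y = - B y x)
    (hnd : ∀ y, (∀ x, B x y = 0) → y = 0) {P : Submodule ℝ V}
    (hP : ∀ x ∈ P, ∀ y ∈ P, B x y = 0) {N : Submodule ℂ (Cx V)} (hNn : Module.finrank ℂ N = n)
    (hN : ∀ x ∈ N, ∀ y ∈ N, B.baseChange ℂ x y = 0) : Module.finrank ℂ (adjoin B P N) = n := by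
  set b := B.baseChange ℂ with hb
  set L := P.baseChange ℂ with hL
  have hnd' : b.Nondegenerate := baseChange_form_nondegenerate hB hnd
  have hdim : Module.finrank ℂ (Cx V) = 2 * n := by rw [Module.finrank_baseChange, hV]
  have horth : ∀ Q : Submodule ℂ (Cx V), Module.finrank ℂ (b.orthogonal Q)
      = 2 * n - Module.finrank ℂ Q := fun Q ↦ by
    rw [LinearMap.BilinForm.finrank_orthogonal hnd', hdim]
  have hNorth : b.orthogonal N = N := by
    have hle : N ≤ b.orthogonal N := fun x hx y hy ↦ hN y hy x hx
    refine (Submodule.eq_of_le_of_finrank_eq hle ?_).symm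
    rw [horth, hNn]
    omega
  have hinf : N ⊓ b.orthogonal L = b.orthogonal (N ⊔ L) := by
    apply le_antisymm
    · rintro x ⟨hx, hx'⟩ y hy
      obtain ⟨y₁, hy₁, y₂, hy₂, rfl⟩ := Submodule.mem_sup.1 hy
      have : b y₂ x = 0 := hx' y₂ hy₂
      change b _ x = 0
      rw [map_add, LinearMap.add_apply, hN y₁ hy₁ x hx, this, add_zero]
    · intro x hx
      refine ⟨?_, fun y hy ↦ hx y (Submodule.mem_sup_right hy)⟩
      have : x ∈ b.orthogonal N := fun y hy ↦ hx y (Submodule.mem_sup_left hy)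
      rwa [hNorth] at this
  have hLL : L ≤ b.orthogonal L := fun x hx y hy ↦ baseChange_isotropic hP hy hx
  have h1 := Submodule.finrank_sup_add_finrank_inf_eq N L
  have h2 := Submodule.finrank_sup_add_finrank_inf_eq (N ⊓ b.orthogonal L) L
  have h3 : N ⊓ b.orthogonal L ⊓ L = N ⊓ L := by
    rw [inf_assoc, inf_eq_right.2 hLL]
  rw [h3] at h2
  have h4 : Module.finrank ℂ ↥(N ⊓ b.orthogonal L) = 2 * n - Module.finrank ℂ ↥(N ⊔ L) := by
    rw [hinf, horth]
  have h5 : Module.finrank ℂ ↥(N ⊔ L) ≤ 2 * n := hdim ▸ Submodule.finrank_le _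
  have h6 : Module.finrank ℂ ↥(N ⊓ L) ≤ Module.finrank ℂ L := Submodule.finrank_mono inf_le_right
  change Module.finrank ℂ ↥(N ⊓ b.orthogonal L ⊔ L) = n
  omega

/-- For y in N ∩ L^⊥ and l in L the number [y + l, conj(y + l)] equals [y, conj y]: L is isotropic
and closed under conjugation, so all the other terms vanish. Moreover y lies outside L when y + l
does. -/
theorem adjoin_dissipative (hB : ∀ x y, B x y = - B y x) {P : Submodule ℝ V}
    (hP : ∀ x ∈ P, ∀ y ∈ P, B x y = 0) {N : Submodule ℂ (Cx V)}
    (hN : ∀ x ∈ N, x ∉ P.baseChange ℂ →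
      0 < (1 / (2 * Complex.I) * B.baseChange ℂ x (conj V x)).re) :
    ∀ x ∈ adjoin B P N, x ∉ P.baseChange ℂ →
      0 < (1 / (2 * Complex.I) * B.baseChange ℂ x (conj V x)).re := by
  intro x hx hxL
  obtain ⟨y, ⟨hy, hy'⟩, l, hl, rfl⟩ := Submodule.mem_sup.1 hx
  have hyL : y ∉ P.baseChange ℂ := fun h ↦ hxL (add_mem h hl)
  have hcl : conj V l ∈ P.baseChange ℂ := conj_mem_baseChange P hl
  have h1 : B.baseChange ℂ y (conj V l) = 0 := by
    rw [baseChange_form_antisymm hB, hy' _ hcl, neg_zero]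
  -- The form is real. This is needed for [l, conj y], which is the conjugate of [conj l, y].
  have h2 : ∀ u v : Cx V, B.baseChange ℂ (conj V u) (conj V v)
      = starRingEnd ℂ (B.baseChange ℂ u v) := fun u v ↦ by
    induction u using TensorProduct.induction_on with
    | zero => simp
    | add u u' hu hu' => simp only [map_add, LinearMap.add_apply, hu, hu']
    | tmul z v' =>
      induction v using TensorProduct.induction_on with
      | zero => simp
      | add v v' hv hv' => simp only [map_add, hv, hv']
      | tmul w u => simp [conj_tmul]
  have hconj : ∀ u : Cx V, conj V (conj V u) = u := fun u ↦ by
    induction u using TensorProduct.induction_on with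
    | zero => simp
    | add u u' hu hu' => simp only [map_add, hu, hu']
    | tmul z v' => simp [conj_tmul]
  have h3 : B.baseChange ℂ l (conj V y) = 0 := by
    have h4 := h2 (conj V l) y
    rw [hconj, hy' _ hcl, map_zero] at h4
    exact h4
  have h5 : B.baseChange ℂ (y + l) (conj V (y + l)) = B.baseChange ℂ y (conj V y) := by
    simp only [map_add, LinearMap.add_apply]
    rw [h1, h3, baseChange_isotropic hP hl hcl]
    simp
  rw [h5]
  exact hN y hy hyL

/-- A map that preserves the form and fixes L pointwise also preserves L^⊥, because [z, f y] = [f z,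
f y] = [z, y] for z in L. -/
theorem push_adjoin_le {P : Submodule ℝ V} {N : Submodule ℂ (Cx V)} {f : V →ₗ[ℝ] V}
    (hf : ∀ x y, B (f x) (f y) = B x y) (hfP : ∀ x ∈ P, f x = x) (hfN : push f N ≤ N) :
    push f (adjoin B P N) ≤ adjoin B P N := by
  have hfix : ∀ l ∈ P.baseChange ℂ, f.baseChange ℂ l = l := fun l hl ↦ by
    rw [Submodule.baseChange_eq_span] at hl
    induction hl using Submodule.span_induction with
    | mem x h =>
      obtain ⟨v, hv, rfl⟩ := h
      simp [hfP v hv]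
    | zero => simp
    | add x y _ _ hx hy => rw [map_add, hx, hy]
    | smul a x _ hx => rw [map_smul, hx]
  rintro _ ⟨x, hx, rfl⟩
  obtain ⟨y, ⟨hy, hy'⟩, l, hl, rfl⟩ := Submodule.mem_sup.1 hx
  rw [map_add, hfix l hl]
  refine Submodule.add_mem_sup ⟨hfN ⟨y, hy, rfl⟩, fun z hz ↦ ?_⟩ hl
  rw [← hfix z hz]
  exact (baseChange_form_baseChange hf z y).trans (hy' z hz)

end ComplexLinearAlgebra

/-! ### The symplectic action of ℝ^k. -/

section Action

variable {n : ℕ} {M : Type*} [TopologicalSpace M]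
  [ChartedSpace (EuclideanSpace ℝ (Fin (2 * n))) M] [IsManifold (𝓡 (2 * n)) ∞ M]

namespace SymplecticForm

variable (Ω : SymplecticForm n M)

theorem action_fin_zero (F : Fin 0 → M → ℝ) (t : Fin 0 → ℝ) (p : M) : Ω.action F t p = p := by
  simp [action]

theorem action_succ {k : ℕ} (F : Fin (k + 1) → M → ℝ) (t : Fin (k + 1) → ℝ) (p : M) :
    Ω.action F t p = Ω.hamFlow (F 0) (t 0)
      (Ω.action (fun j ↦ F j.succ) (fun j ↦ t j.succ) p) := by
  simp [action, List.ofFn_succ]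

theorem action_zero {k : ℕ} {F : Fin k → M → ℝ} (hc : ∀ j, IsCompleteField (Ω.hamField (F j)))
    (p : M) : Ω.action F 0 p = p := by
  induction k with
  | zero => exact Ω.action_fin_zero F 0 p
  | succ k ih =>
    rw [action_succ]
    exact (flow_zero_time (hc 0) _).trans (ih fun j ↦ hc j.succ)

theorem action_single {k : ℕ} {F : Fin k → M → ℝ}
    (hc : ∀ j, IsCompleteField (Ω.hamField (F j))) (j : Fin k) (r : ℝ) (p : M) :
    Ω.action F (Pi.single j r) p = Ω.hamFlow (F j) r p := by
  induction k with
  | zero => exact j.elim0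
  | succ k ih =>
    rw [action_succ]
    induction j using Fin.cases with
    | zero =>
      rw [Pi.single_eq_same, show (fun i : Fin k ↦ (Pi.single 0 r : Fin (k + 1) → ℝ) i.succ) = 0
        from funext fun i ↦ Pi.single_eq_of_ne (Fin.succ_ne_zero i) r]
      rw [Ω.action_zero fun j ↦ hc j.succ]
    | succ i =>
      rw [Pi.single_eq_of_ne (Fin.succ_ne_zero i).symm,
        show (fun l : Fin k ↦ (Pi.single i.succ r : Fin (k + 1) → ℝ) l.succ) = Pi.single i r
        from funext fun l ↦ by simp [Pi.single_apply]]
      exact (flow_zero_time (hc 0) _).trans (ih (fun j ↦ hc j.succ) i)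

variable [T2Space M]

theorem hamFlow_action {k : ℕ} {F : Fin k → M → ℝ}
    (hF : ∀ j, ContMDiff (𝓡 (2 * n)) 𝓘(ℝ, ℝ) ∞ (F j))
    (hc : ∀ j, IsCompleteField (Ω.hamField (F j))) {G : M → ℝ}
    (hG : ContMDiff (𝓡 (2 * n)) 𝓘(ℝ, ℝ) ∞ G) (hcG : IsCompleteField (Ω.hamField G))
    (hGF : ∀ j m, Ω.poisson G (F j) m = 0) (r : ℝ) (t : Fin k → ℝ) (p : M) :
    Ω.hamFlow G r (Ω.action F t p) = Ω.action F t (Ω.hamFlow G r p) := by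
  induction k with
  | zero => rw [action_fin_zero, action_fin_zero]
  | succ k ih =>
    rw [action_succ, action_succ, Ω.hamFlow_comm hG hcG (hF 0) (hc 0) (hGF 0),
      ih (fun j ↦ hF j.succ) (fun j ↦ hc j.succ) fun j ↦ hGF j.succ]

variable {k : ℕ} {F : Fin k → M → ℝ} (hF : ∀ j, ContMDiff (𝓡 (2 * n)) 𝓘(ℝ, ℝ) ∞ (F j))
  (hc : ∀ j, IsCompleteField (Ω.hamField (F j)))

include hF hc

theorem contMDiff_action : ContMDiff (𝓘(ℝ, Fin k → ℝ).prod (𝓡 (2 * n))) (𝓡 (2 * n)) ∞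
    (fun q : (Fin k → ℝ) × M ↦ Ω.action F q.1 q.2) := by
  induction k with
  | zero =>
    refine contMDiff_snd.congr fun q ↦ Ω.action_fin_zero F q.1 q.2
  | succ k ih =>
    have h1 : ContMDiff (𝓘(ℝ, Fin (k + 1) → ℝ).prod (𝓡 (2 * n))) 𝓘(ℝ, Fin k → ℝ) ∞
        (fun q : (Fin (k + 1) → ℝ) × M ↦ fun j : Fin k ↦ q.1 j.succ) := by
      have h : ContDiff ℝ ∞ (fun t : Fin (k + 1) → ℝ ↦ fun j : Fin k ↦ t j.succ) := by fun_prop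
      exact h.contMDiff.comp contMDiff_fst
    have h2 : ContMDiff (𝓘(ℝ, Fin (k + 1) → ℝ).prod (𝓡 (2 * n))) 𝓘(ℝ, ℝ) ∞
        (fun q : (Fin (k + 1) → ℝ) × M ↦ q.1 0) := by
      have h : ContDiff ℝ ∞ (fun t : Fin (k + 1) → ℝ ↦ t 0) := by fun_prop
      exact h.contMDiff.comp contMDiff_fst
    have h3 := (ih (fun j ↦ hF j.succ) fun j ↦ hc j.succ).comp (h1.prodMk contMDiff_snd)
    have h4 := (contMDiff_flow (Ω.isSmoothField_hamField (hF 0)) (hc 0)).comp (h2.prodMk h3)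
    exact h4.congr fun q ↦ Ω.action_succ F q.1 q.2

theorem contMDiff_action_time (t : Fin k → ℝ) :
    ContMDiff (𝓡 (2 * n)) (𝓡 (2 * n)) ∞ (Ω.action F t) :=
  (Ω.contMDiff_action hF hc).comp (contMDiff_const.prodMk contMDiff_id)

theorem mdifferentiableAt_action_time (t : Fin k → ℝ) (p : M) :
    MDifferentiableAt (𝓡 (2 * n)) (𝓡 (2 * n)) (Ω.action F t) p :=
  (Ω.contMDiff_action_time hF hc t).mdifferentiableAt (by simp)

omit hF hc in
theorem der_action_succ {k : ℕ} {F : Fin (k + 1) → M → ℝ}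
    (hF : ∀ j, ContMDiff (𝓡 (2 * n)) 𝓘(ℝ, ℝ) ∞ (F j))
    (hc : ∀ j, IsCompleteField (Ω.hamField (F j))) (t : Fin (k + 1) → ℝ) (p : M) (v : Model n) :
    der (n := n) (Ω.action F t) p v = der (n := n) (Ω.hamFlow (F 0) (t 0))
      (Ω.action (fun j ↦ F j.succ) (fun j ↦ t j.succ) p)
      (der (n := n) (Ω.action (fun j ↦ F j.succ) (fun j ↦ t j.succ)) p v) := by
  rw [show Ω.action F t = fun x ↦ Ω.hamFlow (F 0) (t 0)
    (Ω.action (fun j ↦ F j.succ) (fun j ↦ t j.succ) x) from funext (Ω.action_succ F t)]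
  exact der_comp (mdifferentiableAt_flow_time (Ω.isSmoothField_hamField (hF 0)) (hc 0) _ _)
    (Ω.mdifferentiableAt_action_time (fun j ↦ hF j.succ) (fun j ↦ hc j.succ) _ p) v

theorem form_action (t : Fin k → ℝ) (p : M) (v w : Model n) :
    Ω.form (Ω.action F t p) (der (n := n) (Ω.action F t) p v) (der (n := n) (Ω.action F t) p w)
      = Ω.form p v w := by
  induction k with
  | zero =>
    have h : Ω.action F t = fun x ↦ x := funext (Ω.action_fin_zero F t)
    rw [h, der_id, der_id]
  | succ k ih =>
    rw [Ω.der_action_succ hF hc, Ω.der_action_succ hF hc, action_succ,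
      Ω.form_hamFlow (hF 0) (hc 0)]
    exact ih (fun j ↦ hF j.succ) (fun j ↦ hc j.succ) _

theorem der_action_ham {G : M → ℝ} (hG : ContMDiff (𝓡 (2 * n)) 𝓘(ℝ, ℝ) ∞ G)
    (hFG : ∀ j m, Ω.poisson (F j) G m = 0) (t : Fin k → ℝ) (p : M) :
    der (n := n) (Ω.action F t) p (Ω.ham G p) = Ω.ham G (Ω.action F t p) := by
  induction k with
  | zero =>
    have h : Ω.action F t = fun x ↦ x := funext (Ω.action_fin_zero F t)
    rw [h, der_id]
  | succ k ih =>
    rw [Ω.der_action_succ hF hc, action_succ,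
      ih (fun j ↦ hF j.succ) (fun j ↦ hc j.succ) fun j ↦ hFG j.succ,
      Ω.der_hamFlow_ham (hF 0) (hc 0) hG (hFG 0)]

variable (hFF : ∀ i j m, Ω.poisson (F i) (F j) m = 0)

include hFF

/-- The factors of the ordered composition commute, so the first flow of the inner element can be
moved past the remaining flows of the outer one. -/
theorem action_add (s t : Fin k → ℝ) (p : M) :
    Ω.action F (s + t) p = Ω.action F s (Ω.action F t p) := by
  induction k with
  | zero => simp only [action_fin_zero]
  | succ k ih =>
    rw [action_succ, action_succ, action_succ]
    have h := ih (fun j ↦ hF j.succ) (fun j ↦ hc j.succ) (fun i j m ↦ hFF i.succ j.succ m)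
      (fun j ↦ s j.succ) fun j ↦ t j.succ
    change Ω.hamFlow (F 0) (s 0 + t 0) (Ω.action _ ((fun j ↦ s j.succ) + fun j ↦ t j.succ) p) = _
    rw [h, ← Ω.hamFlow_action (fun j ↦ hF j.succ) (fun j ↦ hc j.succ) (hF 0) (hc 0)
      fun j m ↦ hFF 0 j.succ m]
    exact flow_add (Ω.isSmoothField_hamField (hF 0)) (hc 0) _ _ _

theorem der_action_add (s t : Fin k → ℝ) (p : M) (v : Model n) :
    der (n := n) (Ω.action F (s + t)) p v
      = der (n := n) (Ω.action F s) (Ω.action F t p) (der (n := n) (Ω.action F t) p v) := by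
  rw [show Ω.action F (s + t) = fun x ↦ Ω.action F s (Ω.action F t x) from
    funext (Ω.action_add hF hc hFF s t)]
  exact der_comp (Ω.mdifferentiableAt_action_time hF hc _ _)
    (Ω.mdifferentiableAt_action_time hF hc _ _) v

omit hF hFF [T2Space M] in
theorem der_action_zero (p : M) (v : Model n) : der (n := n) (Ω.action F 0) p v = v := by
  rw [show Ω.action F 0 = fun x ↦ x from funext (Ω.action_zero hc)]
  exact der_id p v

theorem der_action_injective (t : Fin k → ℝ) (p : M) :
    Function.Injective (der (n := n) (Ω.action F t) p) :=
  Function.LeftInverse.injective (g := der (n := n) (Ω.action F (-t)) (Ω.action F t p)) fun v ↦ by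
    rw [← Ω.der_action_add hF hc hFF, neg_add_cancel, Ω.der_action_zero hc]

/-- The velocity of a curve moved by a varying element of `ℝ^k`. -/
theorem hasVelocity_action {s : ℝ → Fin k → ℝ} {γ : ℝ → M} {τ : ℝ} {s' : Fin k → ℝ}
    {v : Model n} (hs : HasDerivAt s s' τ) (hγ : HasVelocity γ τ v) :
    HasVelocity (fun r ↦ Ω.action F (s r) (γ r)) τ
      (∑ j, s' j • Ω.ham (F j) (Ω.action F (s τ) (γ τ))
        + der (n := n) (Ω.action F (s τ)) (γ τ) v) := by
  have hA := ((Ω.contMDiff_action hF hc).mdifferentiableAt (x := (s τ, γ τ))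
    (by simp)).hasMFDerivAt
  -- The joint derivative of the action is linear, so it is determined by its values on (0, v) and
  -- on (e_j, 0). Each value is found by computing the velocity of one suitable curve in two ways.
  let D : (Fin k → ℝ) × Model n →L[ℝ] Model n := mfderiv (𝓘(ℝ, Fin k → ℝ).prod (𝓡 (2 * n)))
    (𝓡 (2 * n)) (fun q : (Fin k → ℝ) × M ↦ Ω.action F q.1 q.2) (s τ, γ τ)
  have hcurve : ∀ (a : ℝ → Fin k → ℝ) (β : ℝ → M) (r : ℝ) (a' : Fin k → ℝ) (w : Model n),
      HasDerivAt a a' r → HasVelocity β r w → a r = s τ → β r = γ τ →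
      HasVelocity (fun r ↦ Ω.action F (a r) (β r)) r (D (a', w)) := by
    intro a β r a' w ha hβ h1 h2
    have h3 := ha.hasFDerivAt.hasMFDerivAt.prodMk hβ
    have hA' : HasMFDerivAt (𝓘(ℝ, Fin k → ℝ).prod (𝓡 (2 * n))) (𝓡 (2 * n))
        (fun q : (Fin k → ℝ) × M ↦ Ω.action F q.1 q.2) (a r, β r) D := by
      rw [h1, h2]
      exact hA
    refine (hA'.comp r h3).congr_mfderiv ?_
    refine ContinuousLinearMap.ext fun (x : ℝ) ↦ ?_
    have h4 : D (x • a', x • w) = x • D (a', w) := D.map_smul x (a', w)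
    exact h4
  have h1 : D (0, v) = der (n := n) (Ω.action F (s τ)) (γ τ) v :=
    (hcurve (fun _ ↦ s τ) γ τ 0 v (hasDerivAt_const τ _) hγ rfl rfl).unique
      (hγ.comp (Ω.mdifferentiableAt_action_time hF hc _ _))
  have h2 : ∀ j, D (Pi.single j 1, 0) = Ω.ham (F j) (Ω.action F (s τ) (γ τ)) := fun j ↦ by
    have ha : HasDerivAt (fun r : ℝ ↦ Pi.single j r + s τ) (Pi.single j (1 : ℝ)) 0 :=
      (ContinuousLinearMap.single ℝ (fun _ : Fin k ↦ ℝ) j).hasDerivAt.add_const _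
    have hβ : HasVelocity (n := n) (fun _ : ℝ ↦ γ τ) 0 0 := by
      refine (hasMFDerivAt_const (γ τ) (0 : ℝ)).congr_mfderiv ?_
      refine ContinuousLinearMap.ext fun (x : ℝ) ↦ ?_
      exact (smul_zero x).symm
    have h := hcurve _ _ 0 _ _ ha hβ (by simp) rfl
    have h3 : (fun r ↦ Ω.action F (Pi.single j r + s τ) (γ τ))
        = fun r ↦ Ω.hamFlow (F j) r (Ω.action F (s τ) (γ τ)) := funext fun r ↦ by
      rw [Ω.action_add hF hc hFF, Ω.action_single hc]
    rw [h3] at h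
    exact h.unique (hasVelocity_flow_zero (hc j) _)
  have h3 : D (s', v) = ∑ j, s' j • D (Pi.single j 1, 0) + D (0, v) := by
    have h4 : (s', v) = ∑ j, s' j • ((Pi.single j 1, 0) : (Fin k → ℝ) × Model n) + (0, v) := by
      refine Prod.ext ?_ ?_
      · ext i
        simp [Prod.fst_sum, Finset.sum_apply, Pi.single_apply]
      · simp [Prod.snd_sum]
    rw [h4, map_add, map_sum]
    simp only [map_smul]
  have h := hcurve s γ τ s' v hs hγ rfl rfl
  rw [h3, h1] at h
  simpa only [h2] using h

end SymplecticForm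

end Action

/-! ### The torus as a single orbit, with a smooth choice of the group element. -/

section Angles

variable {n k : ℕ} {M : Type*} [TopologicalSpace M]
  [ChartedSpace (EuclideanSpace ℝ (Fin (2 * n))) M]

namespace Torus

variable (Λ : Torus n k M)

/-- The derivative of the angle parametrization, with all tangent spaces identified with the
model space. -/
def ptDeriv (θ : Fin k → ℝ) : (Fin k → ℝ) →L[ℝ] Model n :=
  mfderiv 𝓘(ℝ, Fin k → ℝ) (𝓡 (2 * n)) Λ.pt θ

theorem contMDiff_pt : ContMDiff 𝓘(ℝ, Fin k → ℝ) (𝓡 (2 * n)) ∞ Λ.pt := Λ.smooth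

theorem ptDeriv_injective (θ : Fin k → ℝ) : Function.Injective (Λ.ptDeriv θ) := Λ.immersion θ

theorem hasVelocity_pt {c : ℝ → Fin k → ℝ} {c' : Fin k → ℝ} {τ : ℝ} (hc : HasDerivAt c c' τ) :
    HasVelocity (fun r ↦ Λ.pt (c r)) τ (Λ.ptDeriv (c τ) c') := by
  have h := (Λ.contMDiff_pt.mdifferentiableAt (x := c τ) (by simp)).hasMFDerivAt
  refine (h.comp τ hc.hasFDerivAt.hasMFDerivAt).congr_mfderiv ?_
  refine ContinuousLinearMap.ext fun (x : ℝ) ↦ ?_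
  exact (Λ.ptDeriv (c τ)).map_smul x c'

end Torus

variable [IsManifold (𝓡 (2 * n)) ∞ M]

namespace SymplecticForm

variable (Ω : SymplecticForm n M)

/-- The map `v ↦ ∑ v_j J dF_j` at a point. -/
def hamFrame (F : Fin k → M → ℝ) (p : M) : (Fin k → ℝ) →L[ℝ] Model n :=
  ∑ j, (ContinuousLinearMap.proj j : (Fin k → ℝ) →L[ℝ] ℝ).smulRight (Ω.ham (F j) p)

theorem hamFrame_apply (F : Fin k → M → ℝ) (p : M) (v : Fin k → ℝ) :
    Ω.hamFrame F p v = ∑ j, v j • Ω.ham (F j) p := by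
  simp [hamFrame]

theorem hamFrame_injective {F : Fin k → M → ℝ} {p : M}
    (h : LinearIndependent ℝ fun j ↦ diff (n := n) (F j) p) :
    Function.Injective (Ω.hamFrame F p) := by
  have h1 : LinearIndependent ℝ fun j ↦ Ω.hamField (F j) p :=
    h.map' (Ω.J p).toLinearMap (LinearMap.ker_eq_bot.2 (Ω.J p).injective)
  rw [injective_iff_map_eq_zero]
  intro v hv
  rw [hamFrame_apply] at hv
  exact funext (Fintype.linearIndependent_iff.1 h1 v hv)

variable {Ω} {F : Fin k → M → ℝ} {Λ : Torus n k M} (hinv : ∀ j, Λ.IsInvariant Ω (F j))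
  (hindep : ∀ θ, LinearIndependent ℝ fun j ↦ diff (n := n) (F j) (Λ.pt θ))

include hinv hindep

/-- Invariance of the torus gives one inclusion. Both spaces have dimension k, by independence of
the differentials and by the immersion property. -/
theorem range_hamFrame (θ : Fin k → ℝ) :
    LinearMap.range (Ω.hamFrame F (Λ.pt θ)).toLinearMap
      = LinearMap.range (Λ.ptDeriv θ).toLinearMap := by
  refine Submodule.eq_of_le_of_finrank_eq ?_ ?_
  · rintro _ ⟨v, rfl⟩
    change Ω.hamFrame F (Λ.pt θ) v ∈ _
    rw [hamFrame_apply]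
    exact Submodule.sum_mem _ fun j _ ↦ Submodule.smul_mem _ _ (hinv j θ)
  · rw [LinearMap.finrank_range_of_inj (Ω.hamFrame_injective (hindep θ)),
      LinearMap.finrank_range_of_inj (Λ.ptDeriv_injective θ)]

theorem exists_hamFrame_comp_eq (θ : Fin k → ℝ) : ∃ a : (Fin k → ℝ) →L[ℝ] Fin k → ℝ,
    (Ω.hamFrame F (Λ.pt θ)).comp a = Λ.ptDeriv θ := by
  obtain ⟨g, hg⟩ := (Ω.hamFrame F (Λ.pt θ)).toLinearMap.exists_leftInverse_of_injective
    (LinearMap.ker_eq_bot.2 (Ω.hamFrame_injective (hindep θ)))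
  refine ⟨LinearMap.toContinuousLinearMap (g ∘ₗ (Λ.ptDeriv θ).toLinearMap), ?_⟩
  ext1 v
  have h : Λ.ptDeriv θ v ∈ LinearMap.range (Ω.hamFrame F (Λ.pt θ)).toLinearMap := by
    rw [range_hamFrame hinv hindep]
    exact ⟨v, rfl⟩
  obtain ⟨w, hw⟩ := h
  change Ω.hamFrame F (Λ.pt θ) (g (Λ.ptDeriv θ v)) = Λ.ptDeriv θ v
  rw [← hw]
  exact congrArg (Ω.hamFrame F (Λ.pt θ)) (LinearMap.congr_fun hg w)

variable (hF : ∀ j, ContMDiff (𝓡 (2 * n)) 𝓘(ℝ, ℝ) ∞ (F j))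

include hF

omit hinv in
/-- The components of the angle directions with respect to the Hamiltonian fields are smooth. -/
theorem contDiff_of_hamFrame_comp_eq {a : (Fin k → ℝ) → (Fin k → ℝ) →L[ℝ] Fin k → ℝ}
    (ha : ∀ θ, (Ω.hamFrame F (Λ.pt θ)).comp (a θ) = Λ.ptDeriv θ) : ContDiff ℝ ∞ a := by
  rw [contDiff_iff_contDiffAt]
  intro θ₁
  set c := Λ.pt θ₁ with hc
  let ψ : (Fin k → ℝ) → Model n := fun θ ↦ coord (n := n) c (Λ.pt θ)
  have hsrc : ∀ᶠ θ in 𝓝 θ₁, Λ.pt θ ∈ (coord (n := n) c).source :=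
    Λ.contMDiff_pt.continuous.continuousAt.eventually (extChartAt_source_mem_nhds (I := 𝓡 (2 * n)) c)
  have hψ : ContDiffAt ℝ ∞ ψ θ₁ := contMDiffAt_iff_contDiffAt.1
    (ContMDiffAt.comp θ₁ (contMDiffAt_coord c (mem_extChartAt_source c))
      Λ.contMDiff_pt.contMDiffAt)
  let x : Fin k → (Fin k → ℝ) → Model n := fun j θ ↦
    coframe c (ψ θ) (Ω.hamField (F j) ((coord (n := n) c).symm (ψ θ)))
  have hx : ∀ j, ContDiffAt ℝ ∞ (x j) θ₁ := fun j ↦ by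
    have h := (Ω.isSmoothField_hamField (hF j) c).contDiffAt
      ((isOpen_coord_target c).mem_nhds (mem_extChartAt_target c))
    exact ContDiffAt.comp θ₁ h hψ
  let C : (Fin k → ℝ) → Model n →L[ℝ] Model n := fun θ ↦
    mfderiv (𝓡 (2 * n)) 𝓘(ℝ, Model n) (coord (n := n) c) (Λ.pt θ)
  have hCx : ∀ᶠ θ in 𝓝 θ₁, ∀ j, x j θ = C θ (Ω.ham (F j) (Λ.pt θ)) := by
    filter_upwards [hsrc] with θ hθ j
    have h := (coord (n := n) c).left_inv hθ
    have h1 : ∀ p, p = Λ.pt θ → (mfderiv (𝓡 (2 * n)) 𝓘(ℝ, Model n) (coord (n := n) c) p :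
        Model n →L[ℝ] Model n) (Ω.ham (F j) p) = C θ (Ω.ham (F j) (Λ.pt θ)) := by
      rintro _ rfl
      rfl
    exact h1 _ h
  let Y : (Fin k → ℝ) → (Fin k → ℝ) →L[ℝ] Model n := fun θ ↦
    ∑ j, ContinuousLinearMap.smulRightL ℝ (Fin k → ℝ) (Model n) (ContinuousLinearMap.proj j) (x j θ)
  have hY : ContDiffAt ℝ ∞ Y θ₁ := ContDiffAt.sum fun j _ ↦
    (ContinuousLinearMap.contDiff _).contDiffAt.comp θ₁ (hx j)
  have hCY : ∀ᶠ θ in 𝓝 θ₁, Y θ = (C θ).comp (Ω.hamFrame F (Λ.pt θ)) := by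
    filter_upwards [hCx] with θ hθ
    ext1 v
    simp [Y, hamFrame_apply, hθ]
  have hCP : ∀ᶠ θ in 𝓝 θ₁, fderiv ℝ ψ θ = (C θ).comp (Λ.ptDeriv θ) := by
    filter_upwards [hsrc] with θ hθ
    have h := mfderiv_comp θ ((contMDiffAt_coord (n := n) c hθ).mdifferentiableAt (by simp))
      (Λ.contMDiff_pt.mdifferentiableAt (by simp))
    rw [← mfderiv_eq_fderiv]
    exact h
  have hPd : ContDiffAt ℝ ∞ (fderiv ℝ ψ) θ₁ := hψ.fderiv_right (by simp)
  have hYinj : Function.Injective (Y θ₁) := by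
    rw [hCY.self_of_nhds]
    suffices hC : Function.Injective (C θ₁) from hC.comp (Ω.hamFrame_injective (hindep θ₁))
    have hz : ψ θ₁ ∈ (coord (n := n) c).target := mem_extChartAt_target c
    have h := frame_coframe c hz
    have h1 : Function.Injective (coframe c (ψ θ₁)) := Function.LeftInverse.injective h
    have h2 : ∀ p, p = Λ.pt θ₁ → Function.Injective (mfderiv (𝓡 (2 * n)) 𝓘(ℝ, Model n)
        (coord (n := n) c) p) → Function.Injective (C θ₁) := by
      rintro _ rfl h
      exact h
    exact h2 _ (extChartAt_to_inv c) h1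
  -- A left inverse at the single point θ₁ is enough. Near θ₁ the operator G Y(θ) stays invertible,
  -- and then a(θ) = (G Y(θ))⁻¹ G dψ(θ), where the right side is smooth.
  obtain ⟨g, hg⟩ := (Y θ₁).toLinearMap.exists_leftInverse_of_injective
    (LinearMap.ker_eq_bot.2 hYinj)
  let G : Model n →L[ℝ] Fin k → ℝ := LinearMap.toContinuousLinearMap g
  have hGY : G.comp (Y θ₁) = 1 := by
    ext1 v
    exact LinearMap.congr_fun hg v
  have hU : ContDiffAt ℝ ∞ (fun θ ↦ G.comp (Y θ)) θ₁ := contDiffAt_const.clm_comp hY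
  have hunit : ∀ᶠ θ in 𝓝 θ₁, IsUnit (G.comp (Y θ)) := by
    refine hU.continuousAt.eventually (Units.isOpen.mem_nhds ?_)
    change IsUnit (G.comp (Y θ₁))
    rw [hGY]
    exact isUnit_one
  have hI : ContDiffAt ℝ ∞ (fun θ ↦ Ring.inverse (G.comp (Y θ))) θ₁ := by
    refine ContDiffAt.comp θ₁ (g := Ring.inverse) ?_ hU
    rw [hGY]
    exact contDiffAt_ringInverse ℝ 1
  refine (hI.clm_comp ((contDiffAt_const (c := G)).clm_comp hPd)).congr_of_eventuallyEq ?_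
  filter_upwards [hunit, hCY, hCP] with θ h1 h2 h3
  rw [h3, ← ha θ, ← ContinuousLinearMap.comp_assoc (C θ), ← h2, ← ContinuousLinearMap.comp_assoc G]
  have h4 : Ring.inverse (G.comp (Y θ)) * (G.comp (Y θ) * a θ) = a θ :=
    Ring.inverse_mul_cancel_left _ _ h1
  exact h4.symm

variable [T2Space M] (hc : ∀ j, IsCompleteField (Ω.hamField (F j)))
  (hFF : ∀ i j m, Ω.poisson (F i) (F j) m = 0)

include hc hFF

/-- The torus is an orbit, and the element of `ℝ^k` that moves one point to another can be chosen
to depend smoothly on the angles. -/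
theorem exists_smooth_action_eq (θ₀ : Fin k → ℝ) : ∃ s : (Fin k → ℝ) → Fin k → ℝ,
    ContDiff ℝ ∞ s ∧ ∀ θ, Ω.action F (s θ) (Λ.pt θ₀) = Λ.pt θ := by
  choose a ha using exists_hamFrame_comp_eq hinv hindep
  have has : ContDiff ℝ ∞ a := contDiff_of_hamFrame_comp_eq hindep hF ha
  let c : (Fin k → ℝ) → ℝ → Fin k → ℝ := fun θ τ ↦ θ₀ + τ • (θ - θ₀)
  have hac : ∀ θ, Continuous fun r ↦ a (c θ r) := fun θ ↦ has.continuous.comp (by fun_prop)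
  -- The velocity of the torus point along the segment from θ₀ to θ has components a(c)(θ - θ₀) in
  -- the Hamiltonian fields. Their integral is the candidate group element.
  let σ : (Fin k → ℝ) → ℝ → Fin k → ℝ := fun θ τ ↦ (∫ r in (0 : ℝ)..τ, a (c θ r)) (θ - θ₀)
  refine ⟨fun θ ↦ σ θ 1, ?_, fun θ ↦ ?_⟩
  · let u : (Fin k → ℝ) → C(TimeInterval, Fin k → ℝ) := fun θ ↦ ⟨fun τ ↦ c θ τ, by fun_prop⟩
    have hu : ContDiff ℝ ∞ u := by
      let D : (Fin k → ℝ) →L[ℝ] C(TimeInterval, Fin k → ℝ) := LinearMap.toContinuousLinearMap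
        { toFun := fun v ↦ ⟨fun τ ↦ (τ : ℝ) • v, by fun_prop⟩
          map_add' := fun v w ↦ by ext; simp
          map_smul' := fun r v ↦ by ext; simp; ring }
      have h : u = fun θ ↦ ContinuousMap.const _ θ₀ + D (θ - θ₀) := by
        ext θ τ
        rfl
      rw [h]
      exact contDiff_const.add (D.contDiff.comp (contDiff_id.sub contDiff_const))
    have h1 := (contDiff_comp_continuousMap (K := TimeInterval) ⟨a, has.continuous⟩ has).comp hu
    have hmem : (1 : ℝ) ∈ Set.Icc (-1 : ℝ) 2 := by norm_num
    have h2 := ((ContinuousMap.evalCLM ℝ (⟨1, hmem⟩ : TimeInterval)).comp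
      (primitive ((Fin k → ℝ) →L[ℝ] Fin k → ℝ))).contDiff (n := ∞) |>.comp h1
    have h3 := h2.clm_apply (contDiff_id.sub (contDiff_const (c := θ₀)))
    refine Eq.subst (motive := ContDiff ℝ ∞) (funext fun θ ↦ ?_) h3
    refine DFunLike.congr_fun (f := primitive _ _ (⟨1, hmem⟩ : TimeInterval)) ?_ (θ - θ₀)
    rw [primitive_apply]
    symm
    refine intervalIntegral.integral_congr fun r hr ↦ ?_
    rw [Set.uIcc_of_le zero_le_one] at hr
    have hr' : r ∈ Set.Icc (-1 : ℝ) 2 := ⟨by linarith [hr.1], by linarith [hr.2]⟩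
    exact (extendTime_coe ((⟨a, has.continuous⟩ : C(_, _)).comp (u θ)) ⟨r, hr'⟩).symm
  · have hσ : ∀ τ, HasDerivAt (σ θ) (a (c θ τ) (θ - θ₀)) τ := fun τ ↦
      ((hac θ).integral_hasStrictDerivAt 0 τ).hasDerivAt.clm_apply (hasDerivAt_const τ _) |>.congr_deriv
        (by simp)
    have hcd : ∀ τ, HasDerivAt (c θ) (θ - θ₀) τ := fun τ ↦ by
      have h := ((hasDerivAt_id τ).smul_const (θ - θ₀)).const_add θ₀
      rw [one_smul] at h
      exact h
    -- Moving the point c(τ) of the torus back by σ(τ) gives a curve that should stand still. Its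
    -- two velocity terms cancel because the action preserves the Hamiltonian fields.
    have hq : ∀ τ, HasVelocity (n := n) (fun τ ↦ Ω.action F (-σ θ τ) (Λ.pt (c θ τ))) τ 0 :=
      fun τ ↦ by
        have h := Ω.hasVelocity_action hF hc hFF (hσ τ).neg (Λ.hasVelocity_pt (hcd τ))
        have h1 : Λ.ptDeriv (c θ τ) (θ - θ₀)
            = ∑ j, a (c θ τ) (θ - θ₀) j • Ω.ham (F j) (Λ.pt (c θ τ)) := by
          rw [← ha, ← hamFrame_apply]
          rfl
        rw [h1, map_sum] at h
        simp only [map_smul] at h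
        simp_rw [fun j ↦ Ω.der_action_ham hF hc (hF j) (fun i m ↦ hFF i j m)] at h
        rw [← Finset.sum_add_distrib] at h
        have hz : ∀ {w : Model n}, HasVelocity (fun τ ↦ Ω.action F (-σ θ τ) (Λ.pt (c θ τ))) τ w →
            w = 0 → HasVelocity (fun τ ↦ Ω.action F (-σ θ τ) (Λ.pt (c θ τ))) τ (0 : Model n) :=
          fun h e ↦ e ▸ h
        refine hz h (Finset.sum_eq_zero fun j _ ↦ ?_)
        rw [Pi.neg_apply, neg_smul, neg_add_cancel]
    -- Zero velocity means being an integral curve of the zero field, so uniqueness of integral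
    -- curves forces the curve to be constant.
    have hconst := isSmoothField_zero.eq_of_isMIntegralCurve (M := M) (n := n)
      (γ := fun τ ↦ Ω.action F (-σ θ τ) (Λ.pt (c θ τ))) (γ' := fun _ ↦ Λ.pt θ₀) hq
      (isMIntegralCurve_const rfl) ?_
    · have h1 : Ω.action F (-σ θ 1) (Λ.pt (c θ 1)) = Λ.pt θ₀ := congrFun hconst 1
      rw [← h1, ← Ω.action_add hF hc hFF, add_neg_cancel, Ω.action_zero hc]
      simp [c]
    · have h0 : -σ θ 0 = 0 := by simp [σ]
      have h1 : c θ 0 = θ₀ := by simp [c]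
      change Ω.action F (-σ θ 0) (Λ.pt (c θ 0)) = Λ.pt θ₀
      rw [h0, h1, Ω.action_zero hc]

end SymplecticForm

end Angles

/-! ### Transport of a subspace along the orbit. -/

section Orbit

variable {n k : ℕ} {M : Type*} [TopologicalSpace M] [T2Space M]
  [ChartedSpace (EuclideanSpace ℝ (Fin (2 * n))) M] [IsManifold (𝓡 (2 * n)) ∞ M]

omit [T2Space M] [IsManifold (𝓡 (2 * n)) ∞ M] in
theorem tangentCast_apply {p q : M} (h : p = q) (v : Model n) :
    (tangentCast (n := n) h : Model n →L[ℝ] Model n) v = v := by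
  subst h
  rfl

omit [T2Space M] [IsManifold (𝓡 (2 * n)) ∞ M] in
theorem derivAtFixedPoint_eq_der (g : M → M) (m : M) (h : g m = m) :
    derivAtFixedPoint (n := n) g m h = der (n := n) g m :=
  ContinuousLinearMap.ext fun v ↦ tangentCast_apply h (der (n := n) g m v)

namespace SymplecticForm

variable {Ω : SymplecticForm n M} {F : Fin k → M → ℝ}
  (hF : ∀ j, ContMDiff (𝓡 (2 * n)) 𝓘(ℝ, ℝ) ∞ (F j))
  (hc : ∀ j, IsCompleteField (Ω.hamField (F j)))

section Pushforward

include hF hc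

/-- The moved vector is the tangent map of the joint action, applied to the zero vector at s(θ)
together with the fixed vector x. -/
theorem contMDiff_der_action {s : (Fin k → ℝ) → Fin k → ℝ} (hs : ContDiff ℝ ∞ s) (m : M)
    (x : Model n) : ContMDiff 𝓘(ℝ, Fin k → ℝ) (𝓡 (2 * n)).tangent ∞
      (fun θ ↦ (⟨Ω.action F (s θ) m, der (n := n) (Ω.action F (s θ)) m x⟩ :
        TangentBundle (𝓡 (2 * n)) M)) := by
  have hA := Ω.contMDiff_action hF hc
  have h1 : ContMDiff 𝓘(ℝ, Fin k → ℝ) 𝓘(ℝ, Fin k → ℝ).tangent ∞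
      (fun θ ↦ (⟨s θ, 0⟩ : TangentBundle 𝓘(ℝ, Fin k → ℝ) (Fin k → ℝ))) :=
    (Bundle.contMDiff_zeroSection ℝ (TangentSpace 𝓘(ℝ, Fin k → ℝ))).comp hs.contMDiff
  have h2 : ContMDiff 𝓘(ℝ, Fin k → ℝ) (𝓡 (2 * n)).tangent ∞
      (fun _ : Fin k → ℝ ↦ (⟨m, x⟩ : TangentBundle (𝓡 (2 * n)) M)) := contMDiff_const
  have h3 := (hA.contMDiff_tangentMap (m := ∞) (by simp)).comp
    (contMDiff_equivTangentBundleProd_symm.comp (h1.prodMk h2))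
  refine h3.congr fun θ ↦ ?_
  have h4 := (hA.mdifferentiableAt (x := (s θ, m)) (by simp)).hasMFDerivAt.comp m
    ((hasMFDerivAt_const (s θ) m).prodMk (hasMFDerivAt_id m))
  have h5 := hasMFDerivAt_unique (Ω.mdifferentiableAt_action_time hF hc (s θ) m).hasMFDerivAt h4
  exact congrArg (fun v : Model n ↦ (⟨Ω.action F (s θ) m, v⟩ : TangentBundle (𝓡 (2 * n)) M))
    (DFunLike.congr_fun h5 x)

theorem isLagrangian_push (hFF : ∀ i j m, Ω.poisson (F i) (F j) m = 0) {m : M}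
    {N : Submodule ℂ (Cx (Model n))} (h : Ω.IsLagrangian (m := m) N) (s : Fin k → ℝ) :
    Ω.IsLagrangian (m := Ω.action F s m)
      (push (der (n := n) (Ω.action F s) m).toLinearMap N) := by
  refine ⟨(finrank_push (Ω.der_action_injective hF hc hFF s m) N).trans h.1, ?_⟩
  rintro _ ⟨x, hx, rfl⟩ _ ⟨y, hy, rfl⟩
  exact (baseChange_form_baseChange (B := Ω.bilin m) (B' := Ω.bilin (Ω.action F s m))
    (f := (der (n := n) (Ω.action F s) m).toLinearMap) (Ω.form_action hF hc s m) x y).trans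
      (h.2 x hx y hy)

theorem isDissipative_push {m : M} {P : Submodule ℝ (Model n)} {N : Submodule ℂ (Cx (Model n))}
    (h : Ω.IsDissipative (m := m) (P.baseChange ℂ) N) (s : Fin k → ℝ) :
    Ω.IsDissipative (m := Ω.action F s m)
      ((P.map (der (n := n) (Ω.action F s) m).toLinearMap).baseChange ℂ)
      (push (der (n := n) (Ω.action F s) m).toLinearMap N) := by
  rintro _ ⟨x, hx, rfl⟩ hxP
  have hx' : x ∉ P.baseChange ℂ := fun h' ↦ hxP <| by
    rw [← push_baseChange]
    exact ⟨x, h', rfl⟩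
  have h1 := baseChange_form_baseChange (B := Ω.bilin m) (B' := Ω.bilin (Ω.action F s m))
    (f := (der (n := n) (Ω.action F s) m).toLinearMap) (Ω.form_action hF hc s m) x
    (conj (Model n) x)
  have h2 := (congrArg ((Ω.bilin (Ω.action F s m)).baseChange ℂ _)
    (conj_baseChange (der (n := n) (Ω.action F s) m).toLinearMap x)).trans h1
  exact (h x hx hx').trans_eq
    (congrArg (fun z : ℂ ↦ (1 / (2 * Complex.I) * z).re) h2.symm)

theorem der_action_hamFrame (hFF : ∀ i j m, Ω.poisson (F i) (F j) m = 0) (s : Fin k → ℝ) (p : M)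
    (v : Fin k → ℝ) : der (n := n) (Ω.action F s) p (Ω.hamFrame F p v)
      = Ω.hamFrame F (Ω.action F s p) v := by
  rw [hamFrame_apply, hamFrame_apply, map_sum]
  exact Finset.sum_congr rfl fun j _ ↦ by
    rw [map_smul, Ω.der_action_ham hF hc (hF j) fun i m ↦ hFF i j m]

/-- On the torus these ranges are its tangent spaces, so the action carries tangent spaces to
tangent spaces. -/
theorem map_range_hamFrame (hFF : ∀ i j m, Ω.poisson (F i) (F j) m = 0) (s : Fin k → ℝ) (p : M) :
    (LinearMap.range (Ω.hamFrame F p).toLinearMap).map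
      (der (n := n) (Ω.action F s) p).toLinearMap
      = LinearMap.range (Ω.hamFrame F (Ω.action F s p)).toLinearMap := by
  rw [← LinearMap.range_comp]
  congr 1
  exact LinearMap.ext fun v ↦ der_action_hamFrame hF hc hFF s p v

end Pushforward

variable (hFF : ∀ i j m, Ω.poisson (F i) (F j) m = 0)

include hF hc hFF

theorem push_der_action_add (s t : Fin k → ℝ) (m : M) (N : Submodule ℂ (Cx (Model n))) :
    push (der (n := n) (Ω.action F (s + t)) m).toLinearMap N
      = push (der (n := n) (Ω.action F s) (Ω.action F t m)).toLinearMap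
        (push (der (n := n) (Ω.action F t) m).toLinearMap N) := by
  rw [← push_comp]
  congr 1
  exact LinearMap.ext fun v ↦ Ω.der_action_add hF hc hFF s t m v

/-- A subspace invariant under the monodromy operators of generators of the period group is
invariant under all monodromy operators. -/
theorem push_eq_of_isPeriodBasis {m : M} {T : Fin k → Fin k → ℝ} (hT : Ω.IsPeriodBasis F m T)
    {N : Submodule ℂ (Cx (Model n))}
    (hN : ∀ i, push (der (n := n) (Ω.action F (T i)) m).toLinearMap N ≤ N) {t : Fin k → ℝ}
    (ht : Ω.action F t m = m) : push (der (n := n) (Ω.action F t) m).toLinearMap N = N := by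
  have hadd : ∀ {s t : Fin k → ℝ}, Ω.action F t m = m →
      push (der (n := n) (Ω.action F (s + t)) m).toLinearMap N
        = push (der (n := n) (Ω.action F s) m).toLinearMap
          (push (der (n := n) (Ω.action F t) m).toLinearMap N) := fun {s t} ht ↦ by
    have h := push_der_action_add hF hc hFF s t m N
    rwa [ht] at h
  have hzero : ∀ N' : Submodule ℂ (Cx (Model n)),
      push (der (n := n) (Ω.action F 0) m).toLinearMap N' = N' := fun N' ↦ by
    rw [show (der (n := n) (Ω.action F 0) m).toLinearMap = LinearMap.id from
      LinearMap.ext fun v ↦ Ω.der_action_zero hc m v, push_id]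
  -- The periods whose monodromy maps N onto itself form a subgroup, and it contains the generators.
  let S : AddSubgroup (Fin k → ℝ) :=
    { carrier := {t | Ω.action F t m = m ∧
        push (der (n := n) (Ω.action F t) m).toLinearMap N = N}
      zero_mem' := ⟨Ω.action_zero hc m, hzero N⟩
      add_mem' := fun {s t} hs ht ↦ ⟨by rw [Ω.action_add hF hc hFF, ht.1, hs.1], by
        rw [hadd ht.1, ht.2, hs.2]⟩
      neg_mem' := fun {t} ht ↦ ⟨by
        have h := Ω.action_add hF hc hFF (-t) t m
        rw [neg_add_cancel, Ω.action_zero hc, ht.1] at h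
        exact h.symm, by
        have h := hadd (s := -t) ht.1
        rw [neg_add_cancel, ht.2, hzero] at h
        exact h.symm⟩ }
  have hTS : ∀ i, T i ∈ S := fun i ↦ by
    have h : T i ∈ {t : Fin k → ℝ | Ω.action F t m = m} := by
      rw [hT.2]
      exact ⟨Pi.single i 1, by simp [Pi.single_apply]⟩
    exact ⟨h, push_eq_of_le (Ω.der_action_injective hF hc hFF _ m) (hN i)⟩
  have h : t ∈ {t : Fin k → ℝ | Ω.action F t m = m} := ht
  rw [hT.2] at h
  obtain ⟨l, rfl⟩ := h
  exact (S.sum_mem fun i _ ↦ S.zsmul_mem (hTS i) (l i)).2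

omit [T2Space M] hF hc hFF in
open Classical in
/-- The family of the images of a subspace at `m` over the orbit of `m` (and `0` elsewhere). -/
def orbitFamily (Ω : SymplecticForm n M) (F : Fin k → M → ℝ) (m : M)
    (N : Submodule ℂ (Cx (Model n))) (p : M) : Submodule ℂ (Cx (Model n)) :=
  if h : ∃ s, Ω.action F s m = p then push (der (n := n) (Ω.action F h.choose) m).toLinearMap N
  else ⊥

/-- The chosen element t and the given s lead to the same point, so t - s is a period and its
monodromy does not change N. -/
theorem orbitFamily_action {m : M} {N : Submodule ℂ (Cx (Model n))}
    (hN : ∀ t, Ω.action F t m = m → push (der (n := n) (Ω.action F t) m).toLinearMap N = N)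
    (s : Fin k → ℝ) : orbitFamily Ω F m N (Ω.action F s m)
      = push (der (n := n) (Ω.action F s) m).toLinearMap N := by
  have h : ∃ t, Ω.action F t m = Ω.action F s m := ⟨s, rfl⟩
  rw [orbitFamily, dif_pos h]
  set t := h.choose
  have ht : Ω.action F t m = Ω.action F s m := h.choose_spec
  have h1 : Ω.action F (-s + t) m = m := by
    rw [Ω.action_add hF hc hFF, ht, ← Ω.action_add hF hc hFF, neg_add_cancel, Ω.action_zero hc]
  have h2 := push_der_action_add hF hc hFF s (-s + t) m N
  rwa [add_neg_cancel_left, h1, hN _ h1] at h2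

variable {Λ : Torus n k M} (hinv : ∀ j, Λ.IsInvariant Ω (F j))
  (hindep : ∀ θ, LinearIndependent ℝ fun j ↦ diff (n := n) (F j) (Λ.pt θ))

include hinv hindep

/-- The fibre conditions hold at one point and are carried along by symplectic maps that preserve
the tangent spaces. Invariance under the flows is the group law of the action. -/
theorem isComplexGerm_orbitFamily (θ₀ : Fin k → ℝ) {N : Submodule ℂ (Cx (Model n))}
    (hlag : Ω.IsLagrangian (m := Λ.pt θ₀) N) (hdiss : Ω.IsDissipative (Λ.tangentC θ₀) N)
    (hle : Λ.tangentC θ₀ ≤ N)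
    (hN : ∀ t, Ω.action F t (Λ.pt θ₀) = Λ.pt θ₀ →
      push (der (n := n) (Ω.action F t) (Λ.pt θ₀)).toLinearMap N = N) :
    Λ.IsComplexGerm Ω F (orbitFamily Ω F (Λ.pt θ₀) N) := by
  obtain ⟨s, hs, hsm⟩ := exists_smooth_action_eq hinv hindep hF hc hFF θ₀
  set m := Λ.pt θ₀ with hm
  have hr := orbitFamily_action hF hc hFF hN
  have hrange : ∀ θ, Λ.tangentC θ
      = (LinearMap.range (Ω.hamFrame F (Λ.pt θ)).toLinearMap).baseChange ℂ := fun θ ↦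
    congrArg (Submodule.baseChange ℂ) (range_hamFrame hinv hindep θ).symm
  have hle' : (LinearMap.range (Ω.hamFrame F m).toLinearMap).baseChange ℂ ≤ N :=
    (hrange θ₀).symm.trans_le hle
  have hdiss' : Ω.IsDissipative (m := m)
      ((LinearMap.range (Ω.hamFrame F m).toLinearMap).baseChange ℂ) N := by
    have h := hdiss
    rw [hrange θ₀] at h
    exact h
  refine ⟨fun θ₁ ↦ ?_, fun θ ↦ ?_, fun θ ↦ ?_, fun θ ↦ ?_, fun j θ t ↦ ?_⟩
  -- A basis of N, split into real and imaginary parts and moved by g^{s(θ)}, is a smooth frame over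
  -- the whole space of angles. It need not be periodic in θ.
  · let b : Module.Basis (Fin n) ℂ N := Module.finBasisOfFinrankEq ℂ N hlag.1
    choose x y hxy using fun i ↦ exists_eq_re_add_im (V := Model n) (b i : Cx (Model n))
    have hsm' : ∀ v : Model n, ContMDiffOn 𝓘(ℝ, Fin k → ℝ) (𝓡 (2 * n)).tangent ∞
        (fun θ ↦ (⟨Λ.pt θ, der (n := n) (Ω.action F (s θ)) m v⟩ :
          TangentBundle (𝓡 (2 * n)) M)) Set.univ := fun v ↦ by
      refine ((contMDiff_der_action hF hc hs m v).congr fun θ ↦ ?_).contMDiffOn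
      exact congrArg (fun p ↦ (⟨p, der (n := n) (Ω.action F (s θ)) m v⟩ :
        TangentBundle (𝓡 (2 * n)) M)) (hsm θ).symm
    refine ⟨Set.univ, Filter.univ_mem, fun i θ ↦ der (n := n) (Ω.action F (s θ)) m (x i),
      fun i θ ↦ der (n := n) (Ω.action F (s θ)) m (y i), fun i ↦ hsm' _, fun i ↦ hsm' _,
      fun θ _ ↦ ?_⟩
    have h1 : orbitFamily Ω F m N (Λ.pt θ)
        = push (der (n := n) (Ω.action F (s θ)) m).toLinearMap N := by rw [← hr, hsm]
    have h2 : N = Submodule.span ℂ (Set.range fun i ↦ (b i : Cx (Model n))) := by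
      have h := congrArg (Submodule.map N.subtype) b.span_eq
      rw [Submodule.map_span, Submodule.map_top, Submodule.range_subtype, ← Set.range_comp] at h
      exact h.symm
    refine h1.trans ?_
    conv_lhs => rw [h2]
    rw [push, Submodule.map_span, ← Set.range_comp]
    congr 2
    funext i
    simp only [Function.comp, hxy i, map_add, LinearMap.baseChange_tmul]
    rfl
  · have h : Ω.IsLagrangian (m := Ω.action F (s θ) m) (orbitFamily Ω F m N (Ω.action F (s θ) m)) := by
      rw [hr]
      exact isLagrangian_push hF hc hFF hlag (s θ)
    exact hsm θ ▸ h
  · rw [hrange, ← hsm, hr, ← map_range_hamFrame hF hc hFF, ← push_baseChange]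
    exact Submodule.map_mono hle'
  · have h : Ω.IsDissipative (m := Ω.action F (s θ) m)
        ((LinearMap.range (Ω.hamFrame F (Ω.action F (s θ) m)).toLinearMap).baseChange ℂ)
        (orbitFamily Ω F m N (Ω.action F (s θ) m)) := by
      rw [hr, ← map_range_hamFrame hF hc hFF]
      exact isDissipative_push hF hc hdiss' (s θ)
    rw [hrange]
    exact hsm θ ▸ h
  · have h1 : ∀ p, Ω.hamFlow (F j) t p = Ω.action F (Pi.single j t) p := fun p ↦
      (Ω.action_single hc j t p).symm
    have h2 : Ω.hamFlow (F j) t = Ω.action F (Pi.single j t) := funext h1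
    change push (der (n := n) (Ω.hamFlow (F j) t) (Λ.pt θ)).toLinearMap _ = _
    rw [h2, ← hsm θ, hr, ← push_der_action_add hF hc hFF, ← Ω.action_add hF hc hFF, hr]

end SymplecticForm

end Orbit

end Germ

end

/-! ### The theorem. -/

theorem mainTheorem3 {n k : ℕ} (hk : k < n) {M : Type*} [TopologicalSpace M] [T2Space M]
    [ChartedSpace (EuclideanSpace ℝ (Fin (2 * n))) M] [IsManifold (𝓡 (2 * n)) ∞ M]
    (Ω : Germ.SymplecticForm n M) (F : Fin k → M → ℝ)
    (hF : ∀ j, ContMDiff (𝓡 (2 * n)) 𝓘(ℝ, ℝ) ∞ (F j))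
    (hinvol : ∀ i j m, Ω.poisson (F i) (F j) m = 0)
    (hglobal : ∀ j, Germ.IsCompleteField (Ω.hamField (F j)))
    (Λ : Germ.Torus n k M) (hiso : Λ.IsIsotropic Ω) (hinv : ∀ j, Λ.IsInvariant Ω (F j))
    (hindep : ∀ θ, LinearIndependent ℝ fun j ↦ Germ.diff (n := n) (F j) (Λ.pt θ))
    (θ₀ : Fin k → ℝ) (T : Fin k → Fin k → ℝ) (hT : Ω.IsPeriodBasis F (Λ.pt θ₀) T)
    (N : Submodule ℂ (Germ.Cx (TangentSpace (𝓡 (2 * n)) (Λ.pt θ₀))))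
    (hlag : Ω.IsLagrangian N) (hdiss : Ω.IsDissipative (Λ.tangentC θ₀) N)
    (hmono : ∀ (i : Fin k) (hi : Ω.action F (T i) (Λ.pt θ₀) = Λ.pt θ₀),
      Germ.push (Germ.derivAtFixedPoint (n := n) (Ω.action F (T i)) (Λ.pt θ₀) hi).toLinearMap N
        ≤ N) :
    (∃ r : ∀ p : M, Submodule ℂ (Germ.Cx (TangentSpace (𝓡 (2 * n)) p)),
      Λ.IsComplexGerm Ω F r) ∧
    (Λ.tangentC θ₀ ≤ N →
      (∀ θ, ∃ s : Fin k → ℝ, Ω.action F s (Λ.pt θ₀) = Λ.pt θ) ∧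
      ∃ r : ∀ p : M, Submodule ℂ (Germ.Cx (TangentSpace (𝓡 (2 * n)) p)),
        Λ.IsComplexGerm Ω F r ∧
        ∀ s : Fin k → ℝ, r (Ω.action F s (Λ.pt θ₀)) =
          Germ.push (mfderiv (𝓡 (2 * n)) (𝓡 (2 * n)) (Ω.action F s) (Λ.pt θ₀)).toLinearMap N) := by
  have hpoint : ∀ t : Fin k → ℝ, Ω.action F t (Λ.pt θ₀) = Λ.pt θ₀ → ∀ x y : Germ.Model n,
      Ω.form (Λ.pt θ₀) (Germ.der (n := n) (Ω.action F t) (Λ.pt θ₀) x)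
        (Germ.der (n := n) (Ω.action F t) (Λ.pt θ₀) y) = Ω.form (Λ.pt θ₀) x y := fun t ht x y ↦ by
    have h := Ω.form_action hF hglobal t (Λ.pt θ₀) x y
    rwa [ht] at h
  have hTm : ∀ i, Ω.action F (T i) (Λ.pt θ₀) = Λ.pt θ₀ := fun i ↦ by
    have h : T i ∈ {t : Fin k → ℝ | Ω.action F t (Λ.pt θ₀) = Λ.pt θ₀} := by
      rw [hT.2]
      exact ⟨Pi.single i 1, by simp [Pi.single_apply]⟩
    exact h
  have hN : ∀ i, Germ.push (Germ.der (n := n) (Ω.action F (T i)) (Λ.pt θ₀)).toLinearMap N ≤ N :=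
    fun i ↦ by
      have h := hmono i (hTm i)
      rw [Germ.derivAtFixedPoint_eq_der] at h
      exact h
  refine ⟨?_, fun hle ↦ ⟨fun θ ↦ ?_, ?_⟩⟩
  · let N' : Submodule ℂ (Germ.Cx (Germ.Model n)) :=
      Germ.adjoin (Ω.bilin (Λ.pt θ₀)) (Λ.tangent θ₀) N
    have hanti : ∀ x y, Ω.bilin (Λ.pt θ₀) x y = - Ω.bilin (Λ.pt θ₀) y x := Ω.antisymm _
    have hN' : ∀ i, Germ.push (Germ.der (n := n) (Ω.action F (T i)) (Λ.pt θ₀)).toLinearMap N'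
        ≤ N' := fun i ↦ by
      refine Germ.push_adjoin_le (V := Germ.Model n) (B := Ω.bilin (Λ.pt θ₀))
        (hpoint (T i) (hTm i)) (fun x hx ↦ ?_) (hN i)
      -- A tangent vector of the torus is a combination of Hamiltonian fields at m. The action
      -- preserves those fields and g^{T_i} returns to m, so the monodromy fixes the vector.
      obtain ⟨v, rfl⟩ := (Germ.SymplecticForm.range_hamFrame hinv hindep θ₀).symm.le hx
      have h := Germ.SymplecticForm.der_action_hamFrame hF hglobal hinvol (T i) (Λ.pt θ₀) v
      rwa [hTm i] at h
    exact ⟨Germ.SymplecticForm.orbitFamily Ω F (Λ.pt θ₀) N',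
      Germ.SymplecticForm.isComplexGerm_orbitFamily hF hglobal hinvol hinv hindep θ₀
        ⟨Germ.finrank_adjoin finrank_euclideanSpace_fin hanti (Ω.nondegenerate _)
          (hiso θ₀) hlag.1 hlag.2, Germ.adjoin_isotropic hanti (hiso θ₀) hlag.2⟩
        (Germ.adjoin_dissipative hanti (hiso θ₀) hdiss) (Germ.le_adjoin _ _)
        fun _ ht ↦ Germ.SymplecticForm.push_eq_of_isPeriodBasis hF hglobal hinvol hT hN' ht⟩
  · obtain ⟨s, -, hs⟩ :=
      Germ.SymplecticForm.exists_smooth_action_eq hinv hindep hF hglobal hinvol θ₀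
    exact ⟨s θ, hs θ⟩
  · have hstab : ∀ t, Ω.action F t (Λ.pt θ₀) = Λ.pt θ₀ →
        Germ.push (Germ.der (n := n) (Ω.action F t) (Λ.pt θ₀)).toLinearMap N = N := fun _ ht ↦
      Germ.SymplecticForm.push_eq_of_isPeriodBasis hF hglobal hinvol hT hN ht
    exact ⟨Germ.SymplecticForm.orbitFamily Ω F (Λ.pt θ₀) N,
      Germ.SymplecticForm.isComplexGerm_orbitFamily hF hglobal hinvol hinv hindep θ₀ hlag hdiss
        hle hstab,
      Germ.SymplecticForm.orbitFamily_action hF hglobal hinvol hstab⟩
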